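/- Let $0<b_-<b_+<\infty$. Let $b(x)=b_-$ for $x<0$ and $b(x)=b_+$ for $x>0$, and put $\beta(x)=\int_0^x b(s)\,ds$. For $k\in\mathbb R$ let $h(k)=-\frac{d^2}{dx^2}+(k-\beta(x))^2$ be the self-adjoint operator on $L^2(\mathbb R)$ with its maximal domain $\{u\in L^2(\mathbb R): -u''+(k-\beta)^2u\in L^2(\mathbb R)\}$ (derivatives in the sense of distributions); these are the fibre operators of the sharp Iwatsuka model $H=-\partial_x^2+(-i\partial_y-\beta(x))^2$ on $L^2(\mathbb R^2)$. For $k \in \mathbb R$ the eigenvalues of $h(k)$, listed in increasing order, form an infinite sequence $\omega_1(k)<\omega_2(k)<\cdots$ that exhausts the set of eigenvalues. For every integer $j\ge 1$ the band function $k\mapsto\omega_j(k)$ is differentiable on $\mathbb R$ and $\omega_j'(k)>0$ for every $k\in\mathbb R$. In particular every band function is strictly increasing. -/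

import Mathlib

open MeasureTheory Set
open scoped ContDiff

noncomputable section

namespace Iwatsuka

/-- The sharp magnetic field: `bMinus` for `x < 0` and `bPlus` for `x > 0`
(the value at the single point `0` is irrelevant). -/
def field (bMinus bPlus : ℝ) (x : ℝ) : ℝ := if x < 0 then bMinus else bPlus

/-- `β(x) = ∫₀ˣ b(s) ds`. -/
def beta (bMinus bPlus : ℝ) (x : ℝ) : ℝ := ∫ s in (0 : ℝ)..x, field bMinus bPlus s

/-- The effective potential `V(x,k) = (k - β(x))²`. -/
def potential (bMinus bPlus k : ℝ) (x : ℝ) : ℝ := (k - beta bMinus bPlus x) ^ 2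

theorem beta_eq (bMinus bPlus x : ℝ) :
    beta bMinus bPlus x = if x < 0 then bMinus * x else bPlus * x := by
  unfold beta
  split_ifs with hx
  · rw [intervalIntegral.integral_symm,
      intervalIntegral.integral_congr_ae (g := fun _ => bMinus)]
    · simp; ring
    · have h0 : ∀ᵐ s : ℝ, s ≠ 0 := by simp [ae_iff]
      filter_upwards [h0] with s hs hmem
      rw [uIoc_of_le hx.le] at hmem
      simp [field, lt_of_le_of_ne hmem.2 hs]
  · rw [intervalIntegral.integral_congr (g := fun _ => bPlus)]
    · simp; ring
    · intro s hs
      rw [uIcc_of_le (not_lt.mp hx)] at hs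
      simp [field, not_lt.mpr hs.1]

theorem continuous_potential (bMinus bPlus k : ℝ) :
    Continuous (potential bMinus bPlus k) := by
  have h : Continuous (beta bMinus bPlus) := by
    have h' : beta bMinus bPlus = fun x => if x < 0 then bMinus * x else bPlus * x :=
      funext (beta_eq bMinus bPlus)
    rw [h']
    have h2 : (fun x : ℝ => if x < 0 then bMinus * x else bPlus * x) =
        fun x => bMinus * min x 0 + bPlus * max x 0 := by
      funext x
      split_ifs with hx
      · simp [min_eq_left hx.le, max_eq_right hx.le]
      · simp [min_eq_right (not_lt.mp hx), max_eq_left (not_lt.mp hx)]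
    rw [h2]
    fun_prop
  unfold potential
  fun_prop

/-- The Hilbert space `L²(ℝ)` of complex-valued functions. -/
abbrev L2 : Type := Lp ℂ 2 (volume : Measure ℝ)

/-- The formal differential expression `-φ'' + V(·,k) φ` on a test function. -/
def applyFormal (bMinus bPlus k : ℝ) (φ : ℝ → ℝ) (x : ℝ) : ℝ :=
  -deriv (deriv φ) x + potential bMinus bPlus k x * φ x

theorem integrable_test_smul {g : ℝ → ℝ} (hg : Continuous g) (hc : HasCompactSupport g)
    (u : L2) : Integrable fun x => g x • (u x) :=
  ((Lp.memLp u).locallyIntegrable (by norm_num)).integrable_smul_left_of_hasCompactSupport hg hc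

theorem applyFormal_continuous (bMinus bPlus k : ℝ) {φ : ℝ → ℝ} (hφ : ContDiff ℝ ∞ φ) :
    Continuous (applyFormal bMinus bPlus k φ) := by
  have h2 : Continuous (deriv (deriv φ)) := by
    have h1 := (contDiff_infty.mp hφ 2).continuous_iteratedDeriv 2 (by norm_num)
    rwa [iteratedDeriv_succ, iteratedDeriv_one] at h1
  have hV := continuous_potential bMinus bPlus k
  have h0 := hφ.continuous
  unfold applyFormal
  fun_prop

theorem applyFormal_hasCompactSupport (bMinus bPlus k : ℝ) {φ : ℝ → ℝ}
    (hc : HasCompactSupport φ) : HasCompactSupport (applyFormal bMinus bPlus k φ) :=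
  (hc.deriv.deriv.neg).add hc.mul_left

/-- The graph of `h(k)`: the pairs `(u, f)` in `L²(ℝ) × L²(ℝ)` such that
`-u'' + V(·,k) u = f` in the sense of distributions. -/
def fiberGraph (bMinus bPlus k : ℝ) : Submodule ℂ (L2 × L2) where
  carrier := {p | ∀ φ : ℝ → ℝ, ContDiff ℝ ∞ φ → HasCompactSupport φ →
    ∫ x, applyFormal bMinus bPlus k φ x • p.1 x = ∫ x, φ x • p.2 x}
  zero_mem' := by
    intro φ _ _
    have h0 : (fun x => ((0 : L2) : ℝ → ℂ) x) =ᵐ[volume] 0 := Lp.coeFn_zero ℂ 2 volume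
    have key : ∀ g : ℝ → ℝ, ∫ x, g x • ((0 : L2) : ℝ → ℂ) x = 0 := by
      intro g
      rw [integral_eq_zero_of_ae]
      filter_upwards [h0] with x hx
      simp only [hx, Pi.zero_apply, smul_zero]
    simp only [Prod.fst_zero, Prod.snd_zero, key]
  add_mem' := by
    intro p q hp hq φ hφ hc
    have key : ∀ (g : ℝ → ℝ), Continuous g → HasCompactSupport g → ∀ u v : L2,
        ∫ x, g x • ((u + v : L2) : ℝ → ℂ) x = (∫ x, g x • u x) + ∫ x, g x • v x := by
      intro g hg hgc u v
      rw [← integral_add (integrable_test_smul hg hgc u) (integrable_test_smul hg hgc v)]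
      refine integral_congr_ae ?_
      filter_upwards [Lp.coeFn_add u v] with x hx
      rw [hx, Pi.add_apply, smul_add]
    simp only [Prod.fst_add, Prod.snd_add]
    rw [key _ (applyFormal_continuous bMinus bPlus k hφ)
        (applyFormal_hasCompactSupport bMinus bPlus k hc),
      key _ hφ.continuous hc, hp φ hφ hc, hq φ hφ hc]
  smul_mem' := by
    intro c p hp φ hφ hc
    have key : ∀ (g : ℝ → ℝ) (u : L2),
        ∫ x, g x • ((c • u : L2) : ℝ → ℂ) x = c • ∫ x, g x • u x := by
      intro g u
      rw [← integral_smul]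
      refine integral_congr_ae ?_
      filter_upwards [Lp.coeFn_smul c u] with x hx
      simp only [hx, Pi.smul_apply]
      exact smul_comm _ _ _
    simp only [Prod.smul_fst, Prod.smul_snd]
    rw [key, key, hp φ hφ hc]

/-- `fiberGraph` is the graph of a function. -/
theorem fiberGraph_functional (bMinus bPlus k : ℝ) (p : L2 × L2)
    (hp : p ∈ fiberGraph bMinus bPlus k) (h0 : p.1 = 0) : p.2 = 0 := by
  have hz : ∀ φ : ℝ → ℝ, ContDiff ℝ ∞ φ → HasCompactSupport φ → ∫ x, φ x • p.2 x = 0 := by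
    intro φ hφ hc
    rw [← hp φ hφ hc, h0, integral_eq_zero_of_ae]
    filter_upwards [Lp.coeFn_zero ℂ 2 (volume : Measure ℝ)] with x hx
    simp only [hx, Pi.zero_apply, smul_zero]
  have := ae_eq_zero_of_integral_contDiff_smul_eq_zero
    ((Lp.memLp p.2).locallyIntegrable (by norm_num)) hz
  exact (Lp.eq_zero_iff_ae_eq_zero).2 this

/-- The fibre operator `h(k) = -d²/dx² + V(·,k)` on `L²(ℝ)` with its maximal domain
`{u ∈ L² : -u'' + V u ∈ L²}`. As `V` is continuous and nonnegative, this is the unique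
self-adjoint extension (the closure) of the expression on `C₀^∞(ℝ)`. -/
def fiberOp (bMinus bPlus k : ℝ) : L2 →ₗ.[ℂ] L2 := (fiberGraph bMinus bPlus k).toLinearPMap

theorem fiberOp_graph (bMinus bPlus k : ℝ) :
    (fiberOp bMinus bPlus k).graph = fiberGraph bMinus bPlus k :=
  Submodule.toLinearPMap_graph_eq _ (fun p hp h0 => fiberGraph_functional bMinus bPlus k p hp h0)

/-- The set of (real) eigenvalues of `h(k)`. -/
def eigenvalues (bMinus bPlus k : ℝ) : Set ℝ :=
  {E | ∃ ψ : (fiberOp bMinus bPlus k).domain, ψ ≠ 0 ∧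
    fiberOp bMinus bPlus k ψ = (E : ℂ) • (ψ : L2)}

/-- The elements of `S` in increasing order, starting from the smallest one:
each term is the smallest element of `S` beyond the preceding term. -/
def increasingEnum (S : Set ℝ) : ℕ → ℝ
  | 0 => sInf S
  | n + 1 => sInf (S ∩ Ioi (increasingEnum S n))

/-- The band function `ω_j(k)`, `j ≥ 1`: the `j`-th eigenvalue of `h(k)` in increasing order. -/
def band (bMinus bPlus : ℝ) (j : ℕ) (k : ℝ) : ℝ :=
  increasingEnum (eigenvalues bMinus bPlus k) (j - 1)

end Iwatsuka

end

/-! On each half-line the potential is a parabola, so up to scaling there is an explicit solution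
decaying at the corresponding infinity: a parabolic cylinder function of argument `√(2b)(x - k/b)`
and index `E/(2b) - 1/2`. The left half-line is treated by the reflection `x ↦ -x`, `k ↦ -k`. A
number `E` is an eigenvalue exactly when the two decaying solutions match at `0`, that is, when
their Wronskian `F(k,E) = secular` vanishes (`eigenvalues_eq`). The bands are therefore the ordered
zeros of `F(k,·)`, and the implicit function theorem gives `ω' = -F_k/F_E`.

The sign comes from `secularMomentum_mul_secularEnergy_neg`. Let `p` be the right solution and `c ≠
0` the proportionality constant at a zero. Since `k` enters each solution only as a translation by
`k/b`, differentiating in `k` means differentiating in `x`, and `F_k = -c (1/b₋ - 1/b₊)(p'² + (E -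
k²) p²)` at `x = 0`. The `E`-derivative is a sum of Wronskians of a solution with its own
`E`-derivative; these are strictly negative, having a square as derivative and tending to `0` at
infinity, so `c F_E > 0`. It remains to see that the local energy `p'² + (E - V) p²` is positive at
`0`. Its derivative is `-V' p²`. If `k ≤ 0`, then `V` increases on the right half-line, so the
energy decreases to its limit `0` and is positive before; if `k ≥ 0`, the same holds on the left
after reflection, and proportionality transfers the sign. The hypothesis `b₋ < b₊` enters through
`1/b₋ - 1/b₊ > 0`.

Labelling the zeros requires that they be simple (`F_E ≠ 0`), bounded below
(`secular_ne_zero_of_nonpos`) and unbounded above (`exists_secular_eq_zero`).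
`hasDerivAt_increasingEnum_zeros` then shows by induction that the n-th zero is a differentiable
function of `k`.

The identification of the spectrum needs no regularity theory for `u`. If `F(k,E) ≠ 0`, variation of
constants solves `-φ'' + (V - E) φ = f` with decaying `φ` for each test function `f`; testing a weak
eigenfunction `u` against `φ` gives `∫ f u = 0`, hence `u = 0`. The cylinder functions are built
from the integrals of `exp(-zs + s²/2) s^ν` over vertical lines, which give smoothness in `z` and
`ν`, the recurrence, decay and asymptotic positivity. -/

noncomputable section

namespace Iwatsuka

open Filter Topology

/-! ### Laplace-type integrals over vertical lines -/

/-- The point `c + iy`. -/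
def vert (c y : ℝ) : ℂ := (c : ℂ) + (y : ℂ) * Complex.I

/-- The kernel `exp(-zs + s²/2)`. -/
def kern (z : ℝ) (s : ℂ) : ℂ := Complex.exp (-(z : ℂ) * s + s ^ 2 / 2)

/-- The integral of `exp(-zs + s²/2) g(s)` over the line `Re s = c`. -/
def lineInt (c z : ℝ) (g : ℂ → ℂ) : ℂ := ∫ y : ℝ, kern z (vert c y) * g (vert c y)

/-- Continuity and polynomial growth on the half-plane `Re s > 1`. -/
def Tame (g : ℂ → ℂ) : Prop :=
  ContinuousOn g {s | 1 < s.re} ∧ ∃ C : ℝ, ∃ N : ℕ, ∀ s : ℂ, 1 < s.re → ‖g s‖ ≤ C * ‖s‖ ^ N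

@[simp] theorem vert_re (c y : ℝ) : (vert c y).re = c := by simp [vert]

theorem norm_vert_le {c : ℝ} (hc : 1 ≤ c) (y : ℝ) : ‖vert c y‖ ≤ c * (1 + |y|) := by
  have h : ‖vert c y‖ ≤ |c| + |y| := by
    refine (norm_add_le _ _).trans ?_
    simp
  rw [abs_of_nonneg (by linarith)] at h
  nlinarith [abs_nonneg y]

/-- The half-plane starts at `1` and not at `0` for this bound: it makes powers of `‖s‖` monotone in
the exponent, so polynomial bounds can be added and logarithms absorbed. -/
theorem one_le_norm {s : ℂ} (hs : 1 < s.re) : 1 ≤ ‖s‖ :=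
  hs.le.trans ((le_abs_self _).trans (Complex.abs_re_le_norm s))

theorem continuous_vert (c : ℝ) : Continuous (vert c) := by
  unfold vert; fun_prop

theorem norm_kern (z c y : ℝ) :
    ‖kern z (vert c y)‖ = Real.exp (-z * c + c ^ 2 / 2) * Real.exp (-y ^ 2 / 2) := by
  rw [kern, Complex.norm_exp, ← Real.exp_add]
  congr 1
  simp [vert, pow_two]
  ring

/-- The integrable majorant `(1+|y|)^N exp(-y²/2)`. -/
def majorant (N : ℕ) (y : ℝ) : ℝ := (1 + |y|) ^ N * Real.exp (-y ^ 2 / 2)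

theorem majorant_nonneg (N : ℕ) (y : ℝ) : 0 ≤ majorant N y := by
  unfold majorant; positivity

theorem integrable_majorant (N : ℕ) : Integrable (majorant N) := by
  have h := (integrable_exp_neg_mul_sq (b := 1 / 4) (by norm_num)).const_mul
    ((N.factorial : ℝ) * Real.exp 2)
  refine h.mono' (by unfold majorant; fun_prop) (ae_of_all _ fun y => ?_)
  rw [Real.norm_of_nonneg (majorant_nonneg N y), majorant]
  have h1 := Real.pow_div_factorial_le_exp (1 + |y|) (by positivity) N
  rw [div_le_iff₀ (by positivity)] at h1
  -- The exponents compare as `1 + |y| - y²/2 ≤ 2 - y²/4`, which is `(|y| - 2)² ≥ 0`.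
  have h2 : Real.exp (1 + |y|) * Real.exp (-y ^ 2 / 2) ≤
      Real.exp 2 * Real.exp (-(1 / 4) * y ^ 2) := by
    rw [← Real.exp_add, ← Real.exp_add, Real.exp_le_exp]
    nlinarith [sq_nonneg (|y| - 2), sq_abs y]
  calc (1 + |y|) ^ N * Real.exp (-y ^ 2 / 2)
      ≤ Real.exp (1 + |y|) * N.factorial * Real.exp (-y ^ 2 / 2) := by gcongr
    _ = N.factorial * (Real.exp (1 + |y|) * Real.exp (-y ^ 2 / 2)) := by ring
    _ ≤ N.factorial * (Real.exp 2 * Real.exp (-(1 / 4) * y ^ 2)) := by gcongr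
    _ = _ := by ring

theorem norm_integrand_le {g : ℂ → ℂ} {C : ℝ} {N : ℕ}
    (hg : ∀ s : ℂ, 1 < s.re → ‖g s‖ ≤ C * ‖s‖ ^ N) {c : ℝ} (hc : 1 < c) (z y : ℝ) :
    ‖kern z (vert c y) * g (vert c y)‖ ≤
      |C| * (Real.exp (-z * c + c ^ 2 / 2) * c ^ N) * majorant N y := by
  rw [norm_mul, norm_kern, majorant]
  have h1 : ‖g (vert c y)‖ ≤ |C| * (c ^ N * (1 + |y|) ^ N) := by
    refine (hg _ (by simpa using hc)).trans ?_
    rw [← mul_pow]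
    gcongr
    · exact le_abs_self C
    · exact norm_vert_le hc.le y
  calc _ ≤ Real.exp (-z * c + c ^ 2 / 2) * Real.exp (-y ^ 2 / 2) *
        (|C| * (c ^ N * (1 + |y|) ^ N)) := by gcongr
    _ = _ := by ring

theorem continuous_integrand {g : ℂ → ℂ} (hg : Tame g) {c : ℝ} (hc : 1 < c) (z : ℝ) :
    Continuous fun y => kern z (vert c y) * g (vert c y) := by
  have h1 : Continuous fun y => g (vert c y) :=
    hg.1.comp_continuous (continuous_vert c) (fun y => by simpa using hc)
  have h2 : Continuous fun y => kern z (vert c y) := by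
    have := continuous_vert c
    unfold kern; fun_prop
  exact h2.mul h1

theorem integrable_integrand {g : ℂ → ℂ} (hg : Tame g) {c : ℝ} (hc : 1 < c) (z : ℝ) :
    Integrable fun y => kern z (vert c y) * g (vert c y) := by
  obtain ⟨C, N, h⟩ := hg.2
  exact ((integrable_majorant N).const_mul _).mono'
    (continuous_integrand hg hc z).aestronglyMeasurable
    (ae_of_all _ fun y => norm_integrand_le h hc z y)

theorem Tame.add {f g : ℂ → ℂ} (hf : Tame f) (hg : Tame g) : Tame fun s => f s + g s := by
  obtain ⟨C, N, h⟩ := hf.2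
  obtain ⟨C', N', h'⟩ := hg.2
  refine ⟨hf.1.add hg.1, |C| + |C'|, N + N', fun s hs => ?_⟩
  have h1 := one_le_norm hs
  calc ‖f s + g s‖ ≤ C * ‖s‖ ^ N + C' * ‖s‖ ^ N' :=
        (norm_add_le _ _).trans (add_le_add (h s hs) (h' s hs))
    _ ≤ |C| * ‖s‖ ^ (N + N') + |C'| * ‖s‖ ^ (N + N') := by
        gcongr
        · exact le_abs_self C
        · omega
        · exact le_abs_self C'
        · omega
    _ = _ := by ring

theorem Tame.mul {f g : ℂ → ℂ} (hf : Tame f) (hg : Tame g) : Tame fun s => f s * g s := by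
  obtain ⟨C, N, h⟩ := hf.2
  obtain ⟨C', N', h'⟩ := hg.2
  refine ⟨hf.1.mul hg.1, |C| * |C'|, N + N', fun s hs => ?_⟩
  rw [norm_mul]
  calc ‖f s‖ * ‖g s‖ ≤ (|C| * ‖s‖ ^ N) * (|C'| * ‖s‖ ^ N') := by
        gcongr
        · exact (h s hs).trans (by gcongr; exact le_abs_self C)
        · exact (h' s hs).trans (by gcongr; exact le_abs_self C')
    _ = _ := by ring

theorem tame_const (a : ℂ) : Tame fun _ => a :=
  ⟨continuousOn_const, ‖a‖, 0, fun s _ => by simp⟩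

theorem tame_id : Tame fun s => s := ⟨continuousOn_id, 1, 1, fun s _ => by simp⟩

theorem Tame.const_mul {g : ℂ → ℂ} (hg : Tame g) (a : ℂ) : Tame fun s => a * g s :=
  (tame_const a).mul hg

theorem Tame.id_mul {g : ℂ → ℂ} (hg : Tame g) : Tame fun s => s * g s := tame_id.mul hg

theorem lineInt_add {f g : ℂ → ℂ} (hf : Tame f) (hg : Tame g) {c : ℝ} (hc : 1 < c) (z : ℝ) :
    lineInt c z (fun s => f s + g s) = lineInt c z f + lineInt c z g := by
  simp only [lineInt, mul_add]
  exact integral_add (integrable_integrand hf hc z) (integrable_integrand hg hc z)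

theorem lineInt_const_mul (g : ℂ → ℂ) (a : ℂ) (c z : ℝ) :
    lineInt c z (fun s => a * g s) = a * lineInt c z g := by
  simp only [lineInt, mul_left_comm _ a]
  exact integral_const_mul _ _

theorem hasDerivAt_kern_left (z : ℝ) (s : ℂ) :
    HasDerivAt (fun z : ℝ => kern z s) (-(kern z s * s)) z := by
  have h : HasDerivAt (fun w : ℂ => Complex.exp (-w * s + s ^ 2 / 2))
      (Complex.exp (-(z : ℂ) * s + s ^ 2 / 2) * (-1 * s)) (z : ℂ) :=
    ((((hasDerivAt_id (z : ℂ)).neg).mul_const s).add_const _).cexp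
  exact h.comp_ofReal.congr_deriv (by simp [kern])

theorem hasDerivAt_kern_right (z : ℝ) (s : ℂ) :
    HasDerivAt (kern z) (kern z s * (s - z)) s := by
  have h : HasDerivAt (fun s : ℂ => -(z : ℂ) * s + s ^ 2 / 2)
      (-(z : ℂ) * 1 + (2 : ℕ) * s ^ (2 - 1) * 1 / 2) s :=
    ((hasDerivAt_id s).const_mul (-(z : ℂ))).add (((hasDerivAt_id s).pow 2).div_const 2)
  refine h.cexp.congr_deriv ?_
  simp only [kern]
  push_cast
  ring

theorem hasDerivAt_lineInt {g : ℂ → ℂ} (hg : Tame g) {c : ℝ} (hc : 1 < c) (z : ℝ) :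
    HasDerivAt (fun z => lineInt c z g) (-lineInt c z (fun s => s * g s)) z := by
  obtain ⟨C, N, h⟩ := hg.id_mul.2
  have key := (hasDerivAt_integral_of_dominated_loc_of_deriv_le (μ := volume)
    (F := fun (z : ℝ) (y : ℝ) => kern z (vert c y) * g (vert c y))
    (F' := fun (z : ℝ) (y : ℝ) => -(kern z (vert c y) * (vert c y * g (vert c y))))
    (bound := fun y =>
      |C| * (Real.exp ((|z| + 1) * c + c ^ 2 / 2) * c ^ N) * majorant N y)
    (Metric.ball_mem_nhds z one_pos)
    (Eventually.of_forall fun z => (continuous_integrand hg hc z).aestronglyMeasurable)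
    (integrable_integrand hg hc z)
    (continuous_integrand hg.id_mul hc z).neg.aestronglyMeasurable
    (ae_of_all _ fun y x hx => ?_)
    ((integrable_majorant N).const_mul _)
    (ae_of_all _ fun y x _ => ?_)).2
  · exact key.congr_deriv (integral_neg _)
  · rw [norm_neg]
    refine (norm_integrand_le h hc x y).trans ?_
    have hx' : -x ≤ |z| + 1 := by
      rw [Metric.mem_ball, Real.dist_eq, abs_lt] at hx
      linarith [neg_abs_le z]
    have := majorant_nonneg N y
    gcongr
  · exact ((hasDerivAt_kern_left x (vert c y)).mul_const (g (vert c y))).congr_deriv (by ring)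

/-! ### Integration by parts and displacement of the contour -/

section Contour

variable {g g' : ℂ → ℂ}

theorem hasDerivAt_kern_mul (hd : ∀ s : ℂ, 1 < s.re → HasDerivAt g (g' s) s) (z : ℝ) {s : ℂ}
    (hs : 1 < s.re) :
    HasDerivAt (fun s => kern z s * g s) (kern z s * (s * g s + (-(z : ℂ)) * g s + g' s)) s := by
  exact ((hasDerivAt_kern_right z s).mul (hd s hs)).congr_deriv (by ring)

/-- Integration by parts along a vertical line. -/
theorem lineInt_by_parts (hg : Tame g) (hg' : Tame g')
    (hd : ∀ s : ℂ, 1 < s.re → HasDerivAt g (g' s) s) {c : ℝ} (hc : 1 < c) (z : ℝ) :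
    lineInt c z (fun s => s * g s + (-(z : ℂ)) * g s + g' s) = 0 := by
  have hT : Tame (fun s => s * g s + (-(z : ℂ)) * g s + g' s) :=
    (hg.id_mul.add (hg.const_mul _)).add hg'
  have h : ∫ y : ℝ, Complex.I *
      (kern z (vert c y) * ((vert c y) * g (vert c y) + (-(z : ℂ)) * g (vert c y)
        + g' (vert c y))) = 0 := by
    refine integral_eq_zero_of_hasDerivAt_of_integrable
      (f := fun y => kern z (vert c y) * g (vert c y)) (fun y => ?_)
      ((integrable_integrand hT hc z).const_mul _) (integrable_integrand hg hc z)
    have h1 : HasDerivAt (fun w : ℂ => (c : ℂ) + w * Complex.I) Complex.I (y : ℂ) := by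
      simpa using ((hasDerivAt_id (y : ℂ)).mul_const Complex.I).const_add (c : ℂ)
    have h2 := (HasDerivAt.comp (y : ℂ)
      (hasDerivAt_kern_mul hd z (s := vert c y) (by simpa using hc)) h1).comp_ofReal
    exact h2.congr_deriv (by ring)
  rw [integral_const_mul] at h
  exact (mul_eq_zero.1 h).resolve_left Complex.I_ne_zero

theorem lineInt_recurrence (hg : Tame g) (hg' : Tame g')
    (hd : ∀ s : ℂ, 1 < s.re → HasDerivAt g (g' s) s) {c : ℝ} (hc : 1 < c) (z : ℝ) :
    lineInt c z (fun s => s * g s) = z * lineInt c z g - lineInt c z g' := by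
  have h := lineInt_by_parts hg hg' hd hc z
  rw [lineInt_add (hg.id_mul.add (hg.const_mul _)) hg' hc,
    lineInt_add hg.id_mul (hg.const_mul _) hc, lineInt_const_mul] at h
  linear_combination h

/-- The integral does not depend on the line. -/
theorem lineInt_shift (hg : Tame g) (hg' : Tame g')
    (hd : ∀ s : ℂ, 1 < s.re → HasDerivAt g (g' s) s) {c c' : ℝ} (hc : 1 < c) (hc' : 1 < c')
    (z : ℝ) : lineInt c z g = lineInt c' z g := by
  have hT : Tame (fun s => s * g s + (-(z : ℂ)) * g s + g' s) :=
    (hg.id_mul.add (hg.const_mul _)).add hg'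
  have hder : ∀ c ∈ Ioi (1 : ℝ), HasDerivAt (fun c => lineInt c z g) 0 c := by
    intro c hc
    rw [mem_Ioi] at hc
    obtain ⟨C, N, h⟩ := hT.2
    -- Moving the line differentiates the integrand in `s`; this is the same complex derivative
    -- whose integral along the line vanishes.
    rw [← lineInt_by_parts hg hg' hd hc z]
    refine (hasDerivAt_integral_of_dominated_loc_of_deriv_le (μ := volume)
      (F := fun (c : ℝ) (y : ℝ) => kern z (vert c y) * g (vert c y))
      (F' := fun (c : ℝ) (y : ℝ) => kern z (vert c y) *
        ((vert c y) * g (vert c y) + (-(z : ℂ)) * g (vert c y) + g' (vert c y)))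
      (bound := fun y => |C| * (Real.exp (|z| * (c + 1) + (c + 1) ^ 2 / 2) * (c + 1) ^ N)
        * majorant N y)
      (Ioo_mem_nhds hc (lt_add_one c)) ?_
      (integrable_integrand hg hc z)
      (continuous_integrand hT hc z).aestronglyMeasurable
      (ae_of_all _ fun y x hx => ?_)
      ((integrable_majorant N).const_mul _)
      (ae_of_all _ fun y x hx => ?_)).2
    · filter_upwards [Ioi_mem_nhds hc] with x hx
      exact (continuous_integrand hg hx z).aestronglyMeasurable
    · refine (norm_integrand_le h hx.1 z y).trans ?_
      have := majorant_nonneg N y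
      have h1 := hx.1
      have h2 := hx.2
      have h3 : -z * x ≤ |z| * (c + 1) :=
        mul_le_mul (neg_le_abs z) h2.le (by linarith) (abs_nonneg z)
      gcongr
    · have h1 : HasDerivAt (fun w : ℂ => w + (y : ℂ) * Complex.I) 1 (x : ℂ) := by
        simpa using (hasDerivAt_id (x : ℂ)).add_const ((y : ℂ) * Complex.I)
      have h2 := (HasDerivAt.comp (x : ℂ)
        (hasDerivAt_kern_mul hd z (s := vert x y) (by simpa using hx.1)) h1).comp_ofReal
      exact h2.congr_deriv (by ring)
  exact isOpen_Ioi.is_const_of_deriv_eq_zero isPreconnected_Ioi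
    (fun x hx => (hder x hx).differentiableAt.differentiableWithinAt)
    (fun x hx => (hder x hx).deriv) hc hc'

theorem kern_diag (z y : ℝ) : kern z (vert z y) = (Real.exp (-z ^ 2 / 2) : ℂ) *
    (Real.exp (-y ^ 2 / 2) : ℝ) := by
  rw [kern, ← Complex.ofReal_mul, ← Real.exp_add, Complex.ofReal_exp]
  congr 1
  simp only [vert]
  push_cast
  linear_combination (y : ℂ) ^ 2 / 2 * Complex.I_sq

/-- The line is moved to `Re s = z`, through the saddle point of `-zs + s²/2`, where the kernel has
size `exp(-z²/2) exp(-y²/2)`. -/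
theorem exists_norm_lineInt_le (hg : Tame g) (hg' : Tame g')
    (hd : ∀ s : ℂ, 1 < s.re → HasDerivAt g (g' s) s) :
    ∃ C : ℝ, ∃ N : ℕ, ∀ z : ℝ, 1 < z →
      ‖lineInt 2 z g‖ ≤ C * z ^ N * Real.exp (-z ^ 2 / 2) := by
  obtain ⟨C, N, h⟩ := hg.2
  refine ⟨|C| * ∫ y, majorant N y, N, fun z hz => ?_⟩
  rw [lineInt_shift hg hg' hd one_lt_two hz]
  refine (norm_integral_le_of_norm_le ((integrable_majorant N).const_mul _)
    (ae_of_all _ fun y => norm_integrand_le h hz z y)).trans (le_of_eq ?_)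
  rw [integral_const_mul, show -z * z + z ^ 2 / 2 = -z ^ 2 / 2 by ring]
  ring

end Contour

/-! ### The integrals `∫ exp(-zs + s²/2) s^ν (log s)^m` -/

/-- The symbol `s^ν (log s)^m`. -/
def powLog (m : ℕ) (ν : ℝ) (s : ℂ) : ℂ := s ^ (ν : ℂ) * Complex.log s ^ m

theorem mem_slitPlane {s : ℂ} (hs : 1 < s.re) : s ∈ Complex.slitPlane :=
  Or.inl (by linarith)

theorem ne_zero_of_re {s : ℂ} (hs : 1 < s.re) : s ≠ 0 := by
  rintro rfl
  simp at hs
  linarith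

theorem norm_log_le {s : ℂ} (hs : 1 < s.re) : ‖Complex.log s‖ ≤ 5 * ‖s‖ := by
  have h1 := one_le_norm hs
  have h2 : ‖Complex.log s‖ ≤ |Real.log ‖s‖| + |s.arg| := by
    simpa only [Complex.log_re, Complex.log_im] using
      Complex.norm_le_abs_re_add_abs_im (Complex.log s)
  have h3 := Complex.abs_arg_le_pi s
  have h4 := Real.pi_le_four
  rw [abs_of_nonneg (Real.log_nonneg h1)] at h2
  have h5 := Real.log_le_sub_one_of_pos (by linarith : 0 < ‖s‖)
  linarith

theorem norm_powLog_le (m : ℕ) {ν : ℝ} {n : ℕ} (hν : ν ≤ n) {s : ℂ} (hs : 1 < s.re) :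
    ‖powLog m ν s‖ ≤ 5 ^ m * ‖s‖ ^ (n + m) := by
  have h1 := one_le_norm hs
  have h2 : ‖s‖ ^ ν ≤ ‖s‖ ^ n := by
    rw [← Real.rpow_natCast]
    exact Real.rpow_le_rpow_of_exponent_le h1 hν
  rw [powLog, norm_mul, norm_pow, Complex.norm_cpow_real]
  calc ‖s‖ ^ ν * ‖Complex.log s‖ ^ m ≤ ‖s‖ ^ n * (5 * ‖s‖) ^ m := by
        gcongr
        exact norm_log_le hs
    _ = _ := by ring

/-- For `m = 0` the truncated index `m - 1` is harmless, because its coefficient is `0`. The same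
convention is used in the recurrence and in the differential equation. -/
theorem hasDerivAt_powLog (m : ℕ) (ν : ℝ) {s : ℂ} (hs : 1 < s.re) :
    HasDerivAt (powLog m ν)
      ((ν : ℂ) * powLog m (ν - 1) s + (m : ℂ) * powLog (m - 1) (ν - 1) s) s := by
  have h1 := (hasDerivAt_id s).cpow_const (c := (ν : ℂ)) (mem_slitPlane hs)
  have h2 := (Complex.hasDerivAt_log (mem_slitPlane hs)).pow m
  refine (h1.mul h2).congr_deriv ?_
  have h3 : s ^ ((ν : ℂ) - 1) = s ^ (ν : ℂ) * s⁻¹ := by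
    rw [Complex.cpow_sub _ _ (ne_zero_of_re hs), Complex.cpow_one, div_eq_mul_inv]
  simp only [powLog, id, Complex.ofReal_sub, Complex.ofReal_one, h3, Pi.pow_apply]
  ring

theorem tame_powLog (m : ℕ) (ν : ℝ) : Tame (powLog m ν) := by
  refine ⟨fun s hs => (hasDerivAt_powLog m ν hs).continuousAt.continuousWithinAt, 5 ^ m,
    ⌈ν⌉₊ + m, fun s hs => norm_powLog_le m (Nat.le_ceil ν) hs⟩

theorem tame_powLog_deriv (m : ℕ) (ν : ℝ) :
    Tame fun s => (ν : ℂ) * powLog m (ν - 1) s + (m : ℂ) * powLog (m - 1) (ν - 1) s :=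
  ((tame_powLog _ _).const_mul _).add ((tame_powLog _ _).const_mul _)

theorem id_mul_powLog (m : ℕ) (ν : ℝ) {s : ℂ} (hs : 1 < s.re) :
    s * powLog m ν s = powLog m (ν + 1) s := by
  simp only [powLog, Complex.ofReal_add, Complex.ofReal_one,
    Complex.cpow_add _ _ (ne_zero_of_re hs), Complex.cpow_one]
  ring

theorem lineInt_id_mul_powLog (m : ℕ) (ν z : ℝ) :
    lineInt 2 z (fun s => s * powLog m ν s) = lineInt 2 z (powLog m (ν + 1)) := by
  unfold lineInt
  congr 1
  ext y
  exact congrArg _ (id_mul_powLog m ν (by simp))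

/-- Up to the factor `exp(z²/4)`, the parabolic cylinder function of index `ν` for `m = 0`, and
its `m`-th derivative in `ν`. -/
def cyl (m : ℕ) (z ν : ℝ) : ℝ := (lineInt 2 z (powLog m ν)).re

theorem hasDerivAt_cyl_left (m : ℕ) (z ν : ℝ) :
    HasDerivAt (fun z => cyl m z ν) (-cyl m z (ν + 1)) z := by
  have h := hasDerivAt_lineInt (tame_powLog m ν) one_lt_two z
  rw [lineInt_id_mul_powLog] at h
  exact (Complex.reCLM.hasFDerivAt.comp_hasDerivAt z h).congr_deriv (by simp [cyl])

/-- Integration by parts along the line. For `m = 0` this is the three-term recurrence of the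
parabolic cylinder functions; the last term comes from differentiating the logarithm. -/
theorem cyl_add_one (m : ℕ) (z ν : ℝ) :
    cyl m z (ν + 1) = z * cyl m z ν - (ν * cyl m z (ν - 1) + m * cyl (m - 1) z (ν - 1)) := by
  have h := lineInt_recurrence (tame_powLog m ν) (tame_powLog_deriv m ν)
    (fun s hs => hasDerivAt_powLog m ν hs) one_lt_two z
  rw [lineInt_id_mul_powLog, lineInt_add ((tame_powLog _ _).const_mul _)
    ((tame_powLog _ _).const_mul _) one_lt_two, lineInt_const_mul, lineInt_const_mul] at h
  have := congrArg Complex.re h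
  simpa [cyl] using this

theorem hasDerivAt_powLog_exponent (m : ℕ) (ν : ℝ) {s : ℂ} (hs : 1 < s.re) :
    HasDerivAt (fun ν : ℝ => powLog m ν s) (powLog (m + 1) ν s) ν := by
  have h := ((hasDerivAt_id (ν : ℂ)).const_cpow (c := s) (Or.inl (ne_zero_of_re hs))).mul_const
    (Complex.log s ^ m)
  refine h.comp_ofReal.congr_deriv ?_
  simp only [powLog, id]
  ring

theorem norm_integrand_powLog_le (m n : ℕ) {ν R : ℝ} (hν : ν ≤ n) {z : ℝ} (hz : -z ≤ R) (y : ℝ) :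
    ‖kern z (vert 2 y) * powLog m ν (vert 2 y)‖ ≤
      |(5 : ℝ) ^ m| * (Real.exp (R * 2 + 2 ^ 2 / 2) * 2 ^ (n + m)) * majorant (n + m) y := by
  rw [norm_mul, norm_kern, majorant]
  have h1 : ‖powLog m ν (vert 2 y)‖ ≤ |(5 : ℝ) ^ m| * (2 ^ (n + m) * (1 + |y|) ^ (n + m)) := by
    refine (norm_powLog_le m hν (by simp)).trans ?_
    rw [← mul_pow, abs_of_nonneg (by positivity)]
    gcongr
    exact norm_vert_le one_le_two y
  calc _ ≤ Real.exp (R * 2 + 2 ^ 2 / 2) * Real.exp (-y ^ 2 / 2) *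
        (|(5 : ℝ) ^ m| * (2 ^ (n + m) * (1 + |y|) ^ (n + m))) := by gcongr
    _ = _ := by ring

theorem hasDerivAt_cyl_right (m : ℕ) (z ν : ℝ) :
    HasDerivAt (fun ν => cyl m z ν) (cyl (m + 1) z ν) ν := by
  have key := (hasDerivAt_integral_of_dominated_loc_of_deriv_le (μ := volume)
    (F := fun (ν : ℝ) (y : ℝ) => kern z (vert 2 y) * powLog m ν (vert 2 y))
    (F' := fun (ν : ℝ) (y : ℝ) => kern z (vert 2 y) * powLog (m + 1) ν (vert 2 y))
    (bound := fun y => |(5 : ℝ) ^ (m + 1)| * (Real.exp (-z * 2 + 2 ^ 2 / 2) *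
      2 ^ (⌈ν + 1⌉₊ + (m + 1))) * majorant (⌈ν + 1⌉₊ + (m + 1)) y)
    (Iio_mem_nhds (lt_add_one ν))
    (Eventually.of_forall fun ν =>
      (continuous_integrand (tame_powLog m ν) one_lt_two z).aestronglyMeasurable)
    (integrable_integrand (tame_powLog m ν) one_lt_two z)
    (continuous_integrand (tame_powLog (m + 1) ν) one_lt_two z).aestronglyMeasurable
    (ae_of_all _ fun y x hx => norm_integrand_powLog_le _ _
      ((le_of_lt hx).trans (Nat.le_ceil _)) le_rfl y)
    ((integrable_majorant _).const_mul _)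
    (ae_of_all _ fun y x _ => (hasDerivAt_powLog_exponent m x (by simp)).const_mul _)).2
  exact Complex.reCLM.hasFDerivAt.comp_hasDerivAt ν key

theorem continuous_cyl (m : ℕ) : Continuous fun p : ℝ × ℝ => cyl m p.1 p.2 := by
  refine Complex.continuous_re.comp (continuous_iff_continuousAt.2 fun p => ?_)
  refine continuousAt_of_dominated (F := fun (p : ℝ × ℝ) (y : ℝ) =>
      kern p.1 (vert 2 y) * powLog m p.2 (vert 2 y))
    (bound := fun y => |(5 : ℝ) ^ m| * (Real.exp ((-p.1 + 1) * 2 + 2 ^ 2 / 2) *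
      2 ^ (⌈p.2 + 1⌉₊ + m)) * majorant (⌈p.2 + 1⌉₊ + m) y)
    (Eventually.of_forall fun q =>
      (continuous_integrand (tame_powLog m q.2) one_lt_two q.1).aestronglyMeasurable)
    ?_ ((integrable_majorant _).const_mul _) (ae_of_all _ fun y => ?_)
  · have h1 : ∀ᶠ q : ℝ × ℝ in 𝓝 p, p.1 - 1 < q.1 :=
      continuous_fst.continuousAt.eventually (Ioi_mem_nhds (by simp))
    have h2 : ∀ᶠ q : ℝ × ℝ in 𝓝 p, q.2 < p.2 + 1 :=
      continuous_snd.continuousAt.eventually (Iio_mem_nhds (by simp))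
    filter_upwards [h1, h2] with q h1 h2
    exact ae_of_all _ fun y => norm_integrand_powLog_le _ _
      (h2.le.trans (Nat.le_ceil _)) (by linarith) y
  · have hs : vert 2 y ≠ 0 := ne_zero_of_re (by simp)
    unfold kern powLog
    have : Continuous fun p : ℝ × ℝ => vert 2 y ^ ((p.2 : ℝ) : ℂ) :=
      (Complex.continuous_ofReal.comp continuous_snd).const_cpow (Or.inl hs)
    fun_prop

theorem exists_abs_cyl_le (m : ℕ) (ν : ℝ) : ∃ C : ℝ, ∃ N : ℕ, ∀ z : ℝ, 1 < z →
    |cyl m z ν| ≤ C * z ^ N * Real.exp (-z ^ 2 / 2) := by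
  obtain ⟨C, N, h⟩ := exists_norm_lineInt_le (tame_powLog m ν) (tame_powLog_deriv m ν)
    (fun s hs => hasDerivAt_powLog m ν hs)
  exact ⟨C, N, fun z hz => (Complex.abs_re_le_norm _).trans (h z hz)⟩

/-- On the line through the saddle point `s = z` the kernel is a positive real Gaussian and `s^ν =
z^ν (1 + iy/z)^ν`. Once `z^ν` is extracted, the integral tends to that of the Gaussian by dominated
convergence. -/
theorem eventually_cyl_pos (ν : ℝ) : ∀ᶠ z in atTop, 0 < cyl 0 z ν := by
  have hbase : ∀ z : ℝ, 1 < z → cyl 0 z ν = Real.exp (-z ^ 2 / 2) * z ^ ν *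
      (∫ y : ℝ, ((Real.exp (-y ^ 2 / 2) : ℝ) : ℂ) *
        (1 + ((y / z : ℝ) : ℂ) * Complex.I) ^ (ν : ℂ)).re := by
    intro z hz
    have h1 : lineInt 2 z (powLog 0 ν) = ((Real.exp (-z ^ 2 / 2) * z ^ ν : ℝ) : ℂ) *
        ∫ y : ℝ, ((Real.exp (-y ^ 2 / 2) : ℝ) : ℂ) *
          (1 + ((y / z : ℝ) : ℂ) * Complex.I) ^ (ν : ℂ) := by
      rw [lineInt_shift (tame_powLog 0 ν) (tame_powLog_deriv 0 ν)
        (fun s hs => hasDerivAt_powLog 0 ν hs) one_lt_two hz, lineInt, ← integral_const_mul]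
      congr 1
      ext y
      have hz0 : (z : ℂ) ≠ 0 := by exact_mod_cast (by linarith : z ≠ 0)
      have h2 : vert z y = (z : ℂ) * (1 + ((y / z : ℝ) : ℂ) * Complex.I) := by
        simp only [vert]; push_cast; field_simp
      have h3 : (1 + ((y / z : ℝ) : ℂ) * Complex.I) ≠ 0 := by
        intro h
        have := congrArg Complex.re h
        simp at this
      have h4 : vert z y ^ (ν : ℂ) = (z : ℂ) ^ (ν : ℂ) *
          (1 + ((y / z : ℝ) : ℂ) * Complex.I) ^ (ν : ℂ) := by
        have hz' : 0 < z := by linarith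
        rw [h2, Complex.cpow_def_of_ne_zero (mul_ne_zero hz0 h3), Complex.cpow_def_of_ne_zero hz0,
          Complex.cpow_def_of_ne_zero h3, ← Complex.exp_add, Complex.log_ofReal_mul hz' h3,
          Complex.ofReal_log hz'.le]
        ring_nf
      rw [kern_diag, powLog, pow_zero, mul_one, h4, Complex.ofReal_mul,
        Complex.ofReal_cpow (by linarith)]
      ring
    rw [cyl, h1, Complex.re_ofReal_mul]
  have hlim : Tendsto (fun z : ℝ => (∫ y : ℝ, ((Real.exp (-y ^ 2 / 2) : ℝ) : ℂ) *
        (1 + ((y / z : ℝ) : ℂ) * Complex.I) ^ (ν : ℂ)).re) atTop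
      (𝓝 (∫ y : ℝ, ((Real.exp (-y ^ 2 / 2) : ℝ) : ℂ)).re) := by
    refine (Complex.continuous_re.tendsto _).comp ?_
    refine tendsto_integral_filter_of_dominated_convergence (majorant ⌈ν⌉₊) ?_ ?_
      (integrable_majorant _) (ae_of_all _ fun y => ?_)
    · refine Eventually.of_forall fun z => Continuous.aestronglyMeasurable ?_
      refine Continuous.mul (by fun_prop) ?_
      exact Continuous.cpow (by fun_prop) continuous_const
        (fun y => Or.inl (by simp))
    · filter_upwards [eventually_ge_atTop 1] with z hz
      refine ae_of_all _ fun y => ?_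
      have h1 : ‖(1 + ((y / z : ℝ) : ℂ) * Complex.I)‖ ≤ 1 + |y| := by
        refine (norm_add_le _ _).trans ?_
        rw [norm_one, norm_mul, Complex.norm_I, mul_one, Complex.norm_real, Real.norm_eq_abs,
          abs_div, abs_of_pos (by linarith : 0 < z)]
        gcongr
        exact div_le_self (abs_nonneg y) hz
      have h2 : 1 ≤ ‖(1 + ((y / z : ℝ) : ℂ) * Complex.I)‖ := by
        refine le_trans ?_ (Complex.abs_re_le_norm _)
        simp
      rw [norm_mul, Complex.norm_cpow_real, Complex.norm_real,
        Real.norm_of_nonneg (Real.exp_pos _).le, majorant, mul_comm]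
      gcongr
      calc _ ≤ ‖(1 + ((y / z : ℝ) : ℂ) * Complex.I)‖ ^ (⌈ν⌉₊ : ℝ) :=
            Real.rpow_le_rpow_of_exponent_le h2 (Nat.le_ceil ν)
        _ ≤ _ := by
            rw [Real.rpow_natCast]
            gcongr
    · have h1 : Tendsto (fun z : ℝ => 1 + ((y / z : ℝ) : ℂ) * Complex.I) atTop (𝓝 1) := by
        have h0 : Tendsto (fun z : ℝ => y / z) atTop (𝓝 0) := tendsto_const_nhds.div_atTop tendsto_id
        have := ((Complex.continuous_ofReal.tendsto 0).comp h0).mul_const Complex.I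
        simpa using this.const_add (1 : ℂ)
      have h2 := (continuousAt_cpow_const (b := (ν : ℂ)) Complex.one_mem_slitPlane).tendsto.comp h1
      rw [Complex.one_cpow] at h2
      simpa only [mul_one, Function.comp_def] using h2.const_mul ((Real.exp (-y ^ 2 / 2) : ℝ) : ℂ)
  have hpos : 0 < (∫ y : ℝ, ((Real.exp (-y ^ 2 / 2) : ℝ) : ℂ)).re := by
    rw [integral_complex_ofReal, Complex.ofReal_re]
    have : (fun y : ℝ => Real.exp (-y ^ 2 / 2)) = fun y => Real.exp (-(1 / 2) * y ^ 2) := by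
      ext y; congr 1; ring
    rw [this, integral_gaussian]
    positivity
  filter_upwards [hlim.eventually (Ioi_mem_nhds hpos), eventually_gt_atTop 1] with z h1 h2
  rw [hbase z h2]
  have : 0 < z := by linarith
  exact mul_pos (by positivity) h1

/-! ### Parabolic cylinder functions -/

/-- For `m = 0` the solution of `w'' = (z²/4 - ν - 1/2) w` that decays at `+∞`; for general `m`
its `m`-th derivative in `ν`. -/
def weber (m : ℕ) (z ν : ℝ) : ℝ := Real.exp (z ^ 2 / 4) * cyl m z ν

/-- The derivative of `weber m z ν` in `z`. -/
def weberDeriv (m : ℕ) (z ν : ℝ) : ℝ :=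
  Real.exp (z ^ 2 / 4) * (z / 2 * cyl m z ν - cyl m z (ν + 1))

theorem hasDerivAt_exp_sq (z : ℝ) :
    HasDerivAt (fun z : ℝ => Real.exp (z ^ 2 / 4)) (Real.exp (z ^ 2 / 4) * (z / 2)) z := by
  refine (((hasDerivAt_id z).pow 2).div_const 4).exp.congr_deriv ?_
  simp
  ring

theorem hasDerivAt_weber (m : ℕ) (z ν : ℝ) :
    HasDerivAt (fun z => weber m z ν) (weberDeriv m z ν) z := by
  refine ((hasDerivAt_exp_sq z).mul (hasDerivAt_cyl_left m z ν)).congr_deriv ?_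
  rw [weberDeriv]
  ring

/-- Weber's equation, differentiated `m` times in `ν`: the index occurs in the coefficient, which
yields the inhomogeneous term. Each `z`-derivative of `cyl` raises the index, and the recurrence at
`ν + 1` eliminates the index `ν + 2`. -/
theorem hasDerivAt_weberDeriv (m : ℕ) (z ν : ℝ) :
    HasDerivAt (fun z => weberDeriv m z ν)
      ((z ^ 2 / 4 - ν - 1 / 2) * weber m z ν - m * weber (m - 1) z ν) z := by
  have h := (((hasDerivAt_id z).div_const 2).mul (hasDerivAt_cyl_left m z ν)).sub
    (hasDerivAt_cyl_left m z (ν + 1))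
  refine ((hasDerivAt_exp_sq z).mul h).congr_deriv ?_
  have h2 := cyl_add_one m z (ν + 1)
  rw [add_sub_cancel_right] at h2
  simp only [weber, h2, id, Pi.sub_apply, Pi.mul_apply]
  ring

theorem hasDerivAt_weber_index (m : ℕ) (z ν : ℝ) :
    HasDerivAt (fun ν => weber m z ν) (weber (m + 1) z ν) ν :=
  (hasDerivAt_cyl_right m z ν).const_mul _

theorem hasDerivAt_weberDeriv_index (m : ℕ) (z ν : ℝ) :
    HasDerivAt (fun ν => weberDeriv m z ν) (weberDeriv (m + 1) z ν) ν := by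
  have h := (hasDerivAt_cyl_right m z (ν + 1)).comp ν ((hasDerivAt_id ν).add_const 1)
  rw [mul_one] at h
  exact (((hasDerivAt_cyl_right m z ν).const_mul (z / 2)).sub h).const_mul _

theorem continuous_weber (m : ℕ) : Continuous fun p : ℝ × ℝ => weber m p.1 p.2 := by
  have := continuous_cyl m
  unfold weber
  fun_prop

theorem continuous_weberDeriv (m : ℕ) : Continuous fun p : ℝ × ℝ => weberDeriv m p.1 p.2 := by
  have := continuous_cyl m
  have h : Continuous fun p : ℝ × ℝ => cyl m p.1 (p.2 + 1) :=
    (continuous_cyl m).comp (by fun_prop : Continuous fun p : ℝ × ℝ => (p.1, p.2 + 1))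
  unfold weberDeriv
  fun_prop

theorem tendsto_pow_mul_weber (n m : ℕ) (ν : ℝ) :
    Tendsto (fun z => z ^ n * weber m z ν) atTop (𝓝 0) := by
  obtain ⟨C, N, h⟩ := exists_abs_cyl_le m ν
  have h0 : Tendsto (fun z : ℝ => |C| * (z ^ (n + N) * Real.exp (-z))) atTop (𝓝 0) := by
    simpa using (Real.tendsto_pow_mul_exp_neg_atTop_nhds_zero (n + N)).const_mul |C|
  refine squeeze_zero_norm' ?_ h0
  -- For `z ≥ 4` one has `z²/4 ≥ z`, so the net exponent `z²/4 - z²/2` is at most `-z`.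
  filter_upwards [eventually_ge_atTop 4] with z hz
  have hz0 : (0 : ℝ) ≤ z := by linarith
  rw [norm_mul, Real.norm_of_nonneg (pow_nonneg hz0 n), weber, norm_mul,
    Real.norm_of_nonneg (Real.exp_pos _).le, Real.norm_eq_abs]
  have h1 : |cyl m z ν| ≤ |C| * z ^ N * Real.exp (-z ^ 2 / 2) :=
    (h z (by linarith)).trans (by gcongr; exact le_abs_self C)
  have h2 : Real.exp (z ^ 2 / 4) * Real.exp (-z ^ 2 / 2) ≤ Real.exp (-z) := by
    rw [← Real.exp_add, Real.exp_le_exp]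
    nlinarith
  calc z ^ n * (Real.exp (z ^ 2 / 4) * |cyl m z ν|)
      ≤ z ^ n * (Real.exp (z ^ 2 / 4) * (|C| * z ^ N * Real.exp (-z ^ 2 / 2))) := by gcongr
    _ = |C| * z ^ (n + N) * (Real.exp (z ^ 2 / 4) * Real.exp (-z ^ 2 / 2)) := by ring
    _ ≤ |C| * z ^ (n + N) * Real.exp (-z) := by gcongr
    _ = _ := by ring

theorem weberDeriv_eq (m : ℕ) (z ν : ℝ) :
    weberDeriv m z ν = z / 2 * weber m z ν - weber m z (ν + 1) := by
  simp only [weberDeriv, weber]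
  ring

theorem tendsto_pow_mul_weberDeriv (n m : ℕ) (ν : ℝ) :
    Tendsto (fun z => z ^ n * weberDeriv m z ν) atTop (𝓝 0) := by
  have h := ((tendsto_pow_mul_weber (n + 1) m ν).div_const 2).sub
    (tendsto_pow_mul_weber n m (ν + 1))
  simp only [zero_div, sub_zero] at h
  refine h.congr fun z => ?_
  rw [weberDeriv_eq]
  ring

theorem tendsto_weber (m : ℕ) (ν : ℝ) : Tendsto (fun z => weber m z ν) atTop (𝓝 0) := by
  simpa using tendsto_pow_mul_weber 0 m ν

theorem tendsto_weberDeriv (m : ℕ) (ν : ℝ) : Tendsto (fun z => weberDeriv m z ν) atTop (𝓝 0) := by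
  simpa using tendsto_pow_mul_weberDeriv 0 m ν

theorem eventually_weber_pos (ν : ℝ) : ∀ᶠ z in atTop, 0 < weber 0 z ν := by
  filter_upwards [eventually_cyl_pos ν] with z hz
  exact mul_pos (Real.exp_pos _) hz

/-- A nondecreasing function that vanishes at `+∞` and eventually strictly increases is
negative. -/
theorem neg_of_deriv_nonneg_of_tendsto {f f' : ℝ → ℝ} {a : ℝ}
    (hf : ∀ x, HasDerivAt f (f' x) x) (hnn : ∀ x, a ≤ x → 0 ≤ f' x)
    (hpos : ∀ᶠ x in atTop, 0 < f' x) (hlim : Tendsto f atTop (𝓝 0)) : f a < 0 := by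
  obtain ⟨b, hb⟩ := eventually_atTop.1 hpos
  set c := max a b
  have hcont : Continuous f := continuous_iff_continuousAt.2 fun x => (hf x).continuousAt
  have hmono : MonotoneOn f (Ici a) :=
    monotoneOn_of_deriv_nonneg (convex_Ici a) hcont.continuousOn
      (fun x _ => (hf x).differentiableAt.differentiableWithinAt)
      (fun x hx => by rw [(hf x).deriv]; exact hnn x (interior_subset hx))
  have hstrict : StrictMonoOn f (Ici c) :=
    strictMonoOn_of_deriv_pos (convex_Ici c) hcont.continuousOn
      (fun x hx => by
        rw [(hf x).deriv]
        exact hb x ((le_max_right a b).trans (interior_subset hx)))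
  have h1 : f a ≤ f c := hmono self_mem_Ici (le_max_left a b) (le_max_left a b)
  have h2 : f c < f (c + 1) := hstrict self_mem_Ici (by simp) (by simp)
  have h3 : f (c + 1) ≤ 0 := by
    refine ge_of_tendsto hlim ?_
    filter_upwards [eventually_ge_atTop (c + 1)] with x hx
    refine hstrict.monotoneOn (by simp) ?_ hx
    rw [mem_Ici]; linarith
  linarith

/-- By Weber's equation and its `ν`-derivative, this Wronskian has `z`-derivative `weber 0 z ν ^ 2`,
and it vanishes at `+∞`. This negativity later gives both the simplicity of the zeros in `E` and the
sign of `secularEnergy`. -/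
theorem weber_wronskian_index_neg (z ν : ℝ) :
    weber 1 z ν * weberDeriv 0 z ν - weberDeriv 1 z ν * weber 0 z ν < 0 := by
  refine neg_of_deriv_nonneg_of_tendsto
    (f := fun z => weber 1 z ν * weberDeriv 0 z ν - weberDeriv 1 z ν * weber 0 z ν)
    (f' := fun z => weber 0 z ν ^ 2) (fun z => ?_) (fun z _ => sq_nonneg _) ?_ ?_
  · refine (((hasDerivAt_weber 1 z ν).mul (hasDerivAt_weberDeriv 0 z ν)).sub
      ((hasDerivAt_weberDeriv 1 z ν).mul (hasDerivAt_weber 0 z ν))).congr_deriv ?_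
    push_cast
    ring
  · filter_upwards [eventually_weber_pos ν] with z hz
    positivity
  · simpa using ((tendsto_weber 1 ν).mul (tendsto_weberDeriv 0 ν)).sub
      ((tendsto_weberDeriv 1 ν).mul (tendsto_weber 0 ν))

/-- This local energy has derivative `-(z/2) w²`, so it decreases on `[0, ∞)`, and it tends to `0`
at `+∞`. -/
theorem weber_energy_pos {z : ℝ} (hz : 0 ≤ z) (ν : ℝ) :
    0 < weberDeriv 0 z ν ^ 2 + (ν + 1 / 2 - z ^ 2 / 4) * weber 0 z ν ^ 2 := by
  have := neg_of_deriv_nonneg_of_tendsto (a := z)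
    (f := fun z => -(weberDeriv 0 z ν ^ 2 + (ν + 1 / 2 - z ^ 2 / 4) * weber 0 z ν ^ 2))
    (f' := fun z => z / 2 * weber 0 z ν ^ 2) (fun z => ?_)
    (fun x hx => mul_nonneg (by linarith) (sq_nonneg _)) ?_ ?_
  · linarith
  · refine (((hasDerivAt_weberDeriv 0 z ν).pow 2).add (((((hasDerivAt_id z).pow 2).div_const
      4).const_sub (ν + 1 / 2)).mul ((hasDerivAt_weber 0 z ν).pow 2))).neg.congr_deriv ?_
    simp
    ring
  · filter_upwards [eventually_weber_pos ν, eventually_gt_atTop 0] with z hz h0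
    positivity
  · have h1 := (tendsto_weberDeriv 0 ν).pow 2
    have h2 := ((tendsto_weber 0 ν).pow 2).const_mul (ν + 1 / 2)
    have h3 := ((tendsto_pow_mul_weber 1 0 ν).pow 2).const_mul (1 / 4)
    have h4 := ((h1.add h2).sub h3).neg
    simp only [ne_eq, OfNat.ofNat_ne_zero, not_false_eq_true, zero_pow, mul_zero, add_zero,
      sub_zero, neg_zero] at h4
    refine h4.congr fun z => ?_
    ring

/-- Below the bottom of the potential `w²` is convex, since `(w w')' = w'² + (z²/4 - ν - 1/2) w²` is
nonnegative, and `w w'` tends to `0` at `+∞`. -/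
theorem weber_mul_weberDeriv_neg {ν : ℝ} (hν : ν + 1 / 2 ≤ 0) (z : ℝ) :
    weber 0 z ν * weberDeriv 0 z ν < 0 := by
  refine neg_of_deriv_nonneg_of_tendsto (a := z)
    (f := fun z => weber 0 z ν * weberDeriv 0 z ν)
    (f' := fun z => weberDeriv 0 z ν ^ 2 + (z ^ 2 / 4 - ν - 1 / 2) * weber 0 z ν ^ 2)
    (fun z => ?_) (fun x _ => ?_) ?_ ?_
  · refine ((hasDerivAt_weber 0 z ν).mul (hasDerivAt_weberDeriv 0 z ν)).congr_deriv ?_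
    push_cast
    ring
  · have : 0 ≤ x ^ 2 / 4 - ν - 1 / 2 := by nlinarith [sq_nonneg x]
    positivity
  · filter_upwards [eventually_weber_pos ν, eventually_gt_atTop 0] with z hz h0
    have : 0 < z ^ 2 / 4 - ν - 1 / 2 := by nlinarith [sq_pos_of_pos h0]
    positivity
  · simpa using (tendsto_weber 0 ν).mul (tendsto_weberDeriv 0 ν)

theorem weber_add_one (z ν : ℝ) :
    weber 0 z (ν + 1) = z * weber 0 z ν - ν * weber 0 z (ν - 1) := by
  simp only [weber, cyl_add_one 0 z ν]
  push_cast
  ring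

/-- Without zeros beyond `a` the function of `ν` has a constant sign there. The recurrence then
makes four consecutive values of one sign incompatible once `ν ≥ z² + 1`. -/
theorem exists_weber_eq_zero (z a : ℝ) : ∃ ν, a < ν ∧ weber 0 z ν = 0 := by
  by_contra! hne
  have hc : Continuous fun ν => weber 0 z ν :=
    (continuous_weber 0).comp (by fun_prop : Continuous fun ν : ℝ => (z, ν))
  have hsign : (∀ ν ∈ Ioi a, 0 < weber 0 z ν) ∨ (∀ ν ∈ Ioi a, weber 0 z ν < 0) := by
    by_contra! h
    obtain ⟨⟨x, hx, hx'⟩, y, hy, hy'⟩ := h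
    obtain ⟨w, hw, hw'⟩ := isPreconnected_Ioi.intermediate_value hx hy hc.continuousOn
      (show (0 : ℝ) ∈ Icc _ _ from ⟨hx', hy'⟩)
    exact hne w hw hw'
  obtain ⟨σ, hσ⟩ : ∃ σ : ℝ, ∀ ν ∈ Ioi a, 0 < σ * weber 0 z ν := by
    rcases hsign with h | h
    · exact ⟨1, fun ν hν => by simpa using h ν hν⟩
    · exact ⟨-1, fun ν hν => by simpa using h ν hν⟩
  set ν := max (a + 2) (z ^ 2 + 1) with hν
  have h1 : a + 2 ≤ ν := le_max_left _ _
  have h2 : z ^ 2 + 1 ≤ ν := le_max_right _ _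
  have p0 := hσ (ν - 1) (by rw [mem_Ioi]; linarith)
  have p1 := hσ ν (by rw [mem_Ioi]; linarith)
  have p2 := hσ (ν + 1) (by rw [mem_Ioi]; linarith)
  have p3 := hσ (ν + 1 + 1) (by rw [mem_Ioi]; linarith)
  have r1 := weber_add_one z ν
  have r2 := weber_add_one z (ν + 1)
  rw [add_sub_cancel_right] at r2
  rw [r2] at p3
  rw [r1] at p2 p3
  set A := σ * weber 0 z (ν - 1)
  set B := σ * weber 0 z ν
  have hνpos : 0 < ν := by nlinarith [sq_nonneg z]
  have q2 : 0 < z * B - ν * A := by simp only [A, B]; linarith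
  have q3 : 0 < z * (z * B - ν * A) - (ν + 1) * B := by simp only [A, B]; linarith
  have hzB : 0 < z * B := by nlinarith [mul_pos hνpos p0]
  have hz : 0 < z := pos_of_mul_pos_left hzB p1.le
  nlinarith [mul_pos hz (mul_pos hνpos p0)]

/-! ### Zeros of a parameter-dependent function -/

/-! ### Enumeration of a locally finite set that is unbounded above -/

section Enumeration

variable {S : Set ℝ}

theorem isLeast_sInf_of_finite_inter_Iic (hne : S.Nonempty) (hfin : ∀ b, (S ∩ Iic b).Finite) :
    IsLeast S (sInf S) := by
  obtain ⟨x, hx⟩ := hne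
  obtain ⟨m, hm, hmin⟩ := (hfin x).exists_minimal ⟨x, hx, le_refl x⟩
  have : IsLeast S m := by
    refine ⟨hm.1, fun y hy => ?_⟩
    by_contra! hlt
    exact absurd (hmin ⟨hy, hlt.le.trans hm.2⟩ hlt.le) (not_le.2 hlt)
  rwa [this.csInf_eq]

variable (hfin : ∀ b, (S ∩ Iic b).Finite) (hunb : ∀ b, ∃ x ∈ S, b < x)

include hfin hunb

theorem isLeast_sInf_inter_Ioi (c : ℝ) : IsLeast (S ∩ Ioi c) (sInf (S ∩ Ioi c)) := by
  obtain ⟨x, hx, hcx⟩ := hunb c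
  exact isLeast_sInf_of_finite_inter_Iic ⟨x, hx, hcx⟩
    fun b => (hfin b).subset (inter_subset_inter_left _ inter_subset_left)

theorem increasingEnum_mem (n : ℕ) : increasingEnum S n ∈ S := by
  cases n with
  | zero =>
    obtain ⟨x, hx, _⟩ := hunb 0
    exact (isLeast_sInf_of_finite_inter_Iic ⟨x, hx⟩ hfin).1
  | succ n => exact (isLeast_sInf_inter_Ioi hfin hunb _).1.1

theorem strictMono_increasingEnum : StrictMono (increasingEnum S) :=
  strictMono_nat_of_lt_succ fun _ => (isLeast_sInf_inter_Ioi hfin hunb _).1.2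

/-- An element that is never reached would lie above all terms, leaving infinitely many elements of
`S` below it. -/
theorem range_increasingEnum : range (increasingEnum S) = S := by
  refine Subset.antisymm (range_subset_iff.2 (increasingEnum_mem hfin hunb)) fun x hx => ?_
  by_contra hnot
  have hlt : ∀ n, increasingEnum S n < x := by
    intro n
    refine lt_of_le_of_ne ?_ fun h => hnot ⟨n, h⟩
    induction n with
    | zero => exact (isLeast_sInf_of_finite_inter_Iic ⟨x, hx⟩ hfin).2 hx
    | succ n ih =>
      exact (isLeast_sInf_inter_Ioi hfin hunb _).2
        ⟨hx, lt_of_le_of_ne ih fun h => hnot ⟨n, h⟩⟩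
  refine infinite_range_of_injective (strictMono_increasingEnum hfin hunb).injective
    ((hfin x).subset ?_)
  rintro _ ⟨n, rfl⟩
  exact ⟨increasingEnum_mem hfin hunb n, (hlt n).le⟩

end Enumeration

/-! ### Differentiable branches of zeros -/

section Branches

variable {F F₁ F₂ : ℝ → ℝ → ℝ}

theorem exists_local_branch
    (h₁ : ∀ k E, HasDerivAt (fun k => F k E) (F₁ k E) k)
    (h₂ : ∀ k E, HasDerivAt (fun E => F k E) (F₂ k E) E)
    (c₁ : Continuous fun p : ℝ × ℝ => F₁ p.1 p.2) (c₂ : Continuous fun p : ℝ × ℝ => F₂ p.1 p.2)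
    {k₀ E₀ : ℝ} (h0 : F k₀ E₀ = 0) (hne : F₂ k₀ E₀ ≠ 0) :
    ∃ g : ℝ → ℝ, g k₀ = E₀ ∧ HasDerivAt g (-F₁ k₀ E₀ / F₂ k₀ E₀) k₀ ∧
      ∀ᶠ v in 𝓝 (k₀, E₀), F v.1 v.2 = 0 ↔ g v.1 = v.2 := by
  have hF := hasStrictFDerivAt_uncurry_coprod (𝕜 := ℝ) (u := (k₀, E₀)) (f := F)
    (f₁ := fun k E => ContinuousLinearMap.toSpanSingleton ℝ (F₁ k E))
    (f₂ := fun k E => ContinuousLinearMap.toSpanSingleton ℝ (F₂ k E))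
    (Eventually.of_forall fun v => (h₁ v.1 v.2).hasFDerivAt)
    (Eventually.of_forall fun v => (h₂ v.1 v.2).hasFDerivAt)
    ((ContinuousLinearMap.toSpanSingletonCLE (𝕜 := ℝ) (E := ℝ)).continuous.comp c₁).continuousAt
    ((ContinuousLinearMap.toSpanSingletonCLE (𝕜 := ℝ) (E := ℝ)).continuous.comp c₂).continuousAt
  set A := (ContinuousLinearMap.toSpanSingleton ℝ (F₁ k₀ E₀)).coprod
    (ContinuousLinearMap.toSpanSingleton ℝ (F₂ k₀ E₀)) with hA
  have hF : HasStrictFDerivAt (fun v : ℝ × ℝ => F v.1 v.2) A (k₀, E₀) := hF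
  have hinv : (A ∘L .inr ℝ ℝ ℝ).IsInvertible := by
    refine ⟨ContinuousLinearEquiv.unitsEquivAut ℝ (Units.mk0 _ hne), ?_⟩
    ext
    simp [A]
  set g := hF.implicitFunctionOfProdDomain hinv
  have hiff := hF.eventually_apply_eq_iff_implicitFunctionOfProdDomain hinv
  simp only [h0] at hiff
  have hg0 : g k₀ = E₀ := hiff.self_of_nhds.1 h0
  have hgd : DifferentiableAt ℝ g k₀ :=
    (hF.hasStrictFDerivAt_implicitFunctionOfProdDomain hinv).hasFDerivAt.differentiableAt
  refine ⟨g, hg0, ?_, hiff⟩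
  have hcurve : HasDerivAt (fun k => (k, g k)) (1, deriv g k₀) k₀ :=
    (hasDerivAt_id k₀).prodMk hgd.hasDerivAt
  have hcomp : HasDerivAt (fun k => F k (g k)) (A (1, deriv g k₀)) k₀ := by
    have hF' : HasFDerivAt (fun v : ℝ × ℝ => F v.1 v.2) A (k₀, g k₀) := by
      rw [hg0]; exact hF.hasFDerivAt
    exact hF'.comp_hasDerivAt k₀ hcurve
  have hzero : (fun k => F k (g k)) =ᶠ[𝓝 k₀] fun _ => 0 := by
    have := hF.eventually_apply_implicitFunctionOfProdDomain hinv
    simp only [h0] at this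
    exact this
  have hd := hcomp.unique ((hasDerivAt_const k₀ (0 : ℝ)).congr_of_eventuallyEq hzero)
  simp only [A, ContinuousLinearMap.coprod_apply, ContinuousLinearMap.toSpanSingleton_apply,
    smul_eq_mul, one_mul] at hd
  refine hgd.hasDerivAt.congr_deriv ?_
  rw [eq_div_iff hne]
  linarith

/-- Infinitely many zeros in a compact interval would accumulate at a zero, but simple zeros are
isolated. -/
theorem finite_zeros_inter_Iic {f f' : ℝ → ℝ} (hf : ∀ x, HasDerivAt f (f' x) x)
    (hne : ∀ x, f x = 0 → f' x ≠ 0) {a : ℝ} (ha : ∀ x ≤ a, f x ≠ 0) (b : ℝ) :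
    ({x | f x = 0} ∩ Iic b).Finite := by
  by_contra hinf
  have hsub : {x | f x = 0} ∩ Iic b ⊆ Icc a b := fun x hx =>
    ⟨le_of_not_ge fun h => ha x h hx.1, hx.2⟩
  obtain ⟨x, -, hx⟩ := Set.Infinite.exists_accPt_of_subset_isCompact hinf isCompact_Icc hsub
  have hcont : Continuous f := continuous_iff_continuousAt.2 fun x => (hf x).continuousAt
  have hfreq := (accPt_iff_frequently_nhdsNE.1 hx).mono fun y hy => hy.1
  have hx0 : f x = 0 :=
    (isClosed_eq hcont continuous_const).mem_of_frequently_of_tendsto hfreq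
      (tendsto_id.mono_left nhdsWithin_le_nhds)
  exact hfreq ((hf x).eventually_ne (c := 0) (hne x hx0))

variable
    (h₁ : ∀ k E, HasDerivAt (fun k => F k E) (F₁ k E) k)
    (h₂ : ∀ k E, HasDerivAt (fun E => F k E) (F₂ k E) E)
    (c₁ : Continuous fun p : ℝ × ℝ => F₁ p.1 p.2) (c₂ : Continuous fun p : ℝ × ℝ => F₂ p.1 p.2)
    (c : Continuous fun p : ℝ × ℝ => F p.1 p.2)
    (hne : ∀ k E, F k E = 0 → F₂ k E ≠ 0)

include h₁ h₂ c₁ c₂ c hne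

/-- The first zero beyond a continuous curve is differentiable in the parameter. -/
theorem hasDerivAt_next_zero {α N : ℝ → ℝ} {k₀ : ℝ} (hα : ContinuousAt α k₀)
    (hN : ∀ k, IsLeast ({E | F k E = 0} ∩ Ioi (α k)) (N k))
    (hiso : ∀ᶠ v : ℝ × ℝ in 𝓝 (k₀, α k₀), α v.1 < v.2 → F v.1 v.2 ≠ 0) :
    HasDerivAt N (-F₁ k₀ (N k₀) / F₂ k₀ (N k₀)) k₀ ∧
      ∀ᶠ v : ℝ × ℝ in 𝓝 (k₀, N k₀), N v.1 < v.2 → F v.1 v.2 ≠ 0 := by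
  obtain ⟨g, hg0, hgd, hiff⟩ := exists_local_branch h₁ h₂ c₁ c₂ (hN k₀).1.1
    (hne _ _ (hN k₀).1.1)
  have hgc : Tendsto g (𝓝 k₀) (𝓝 (N k₀)) := hg0 ▸ hgd.continuousAt.tendsto
  have hgz : ∀ᶠ k in 𝓝 k₀, F k (g k) = 0 := by
    filter_upwards [(tendsto_id.prodMk_nhds hgc).eventually hiff] with k hk
    exact hk.2 rfl
  have hlim : Tendsto N (𝓝 k₀) (𝓝 (N k₀)) := by
    refine tendsto_order.2 ⟨fun e he => ?_, fun e he => ?_⟩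
    -- No zero can appear between the curve `α` and `e < N k₀`: each point of the compact interval
    -- has a neighbourhood free of zeros above `α`. At `α k₀` itself this is the isolation
    -- hypothesis.
    · have hcomp := (isCompact_Icc (a := α k₀ - 1) (b := e)).eventually_forall_of_forall_eventually
        (x₀ := k₀) (P := fun k E => α k < E → F k E ≠ 0) (fun E hE => ?_)
      · filter_upwards [hcomp, hα.eventually (Ioi_mem_nhds (sub_one_lt (α k₀)))] with k hk hk'
        by_contra! hle
        exact hk (N k) ⟨hk'.le.trans (hN k).1.2.le, hle⟩ (hN k).1.2 (hN k).1.1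
      · rcases lt_trichotomy E (α k₀) with h | h | h
        · have : ∀ᶠ v : ℝ × ℝ in 𝓝 (k₀, E), v.2 < α v.1 :=
            (continuousAt_snd).eventually_lt (ContinuousAt.comp (x := (k₀, E)) hα continuousAt_fst) h
          filter_upwards [this] with v hv hv'
          exact absurd hv hv'.not_gt
        · rw [h]; exact hiso
        · have hEne : F k₀ E ≠ 0 := fun h0 =>
            absurd ((hN k₀).2 ⟨h0, h⟩) (not_le.2 (hE.2.trans_lt he))
          filter_upwards [c.continuousAt.eventually_ne (x := (k₀, E)) hEne] with v hv _
          exact hv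
    -- In the other direction, the local branch `g` consists of zeros above `α`, so `N ≤ g` near
    -- `k₀`.
    · have hpos : ∀ᶠ k in 𝓝 k₀, α k < g k := hα.eventually_lt hgd.continuousAt (by
        rw [hg0]; exact (hN k₀).1.2)
      filter_upwards [hgz, hpos, hgc.eventually (Iio_mem_nhds he)] with k h1 h2 h3
      exact ((hN k).2 ⟨h1, h2⟩).trans_lt h3
  have heq : N =ᶠ[𝓝 k₀] g := by
    filter_upwards [(tendsto_id.prodMk_nhds hlim).eventually hiff] with k hk
    exact (hk.1 (hN k).1.1).symm
  refine ⟨hgd.congr_of_eventuallyEq heq, ?_⟩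
  filter_upwards [hiff, continuousAt_fst.eventually heq] with v h1 h2 h3 h4
  rw [h2, h1.1 h4] at h3
  exact h3.false

theorem hasDerivAt_increasingEnum_zeros {a : ℝ} (ha : ∀ k, ∀ E ≤ a, F k E ≠ 0)
    (hunb : ∀ k b, ∃ E ∈ {E | F k E = 0}, b < E) (n : ℕ) (k : ℝ) :
    HasDerivAt (fun k => increasingEnum {E | F k E = 0} n)
      (-F₁ k (increasingEnum {E | F k E = 0} n) / F₂ k (increasingEnum {E | F k E = 0} n)) k := by
  have hfin : ∀ k b, ({E | F k E = 0} ∩ Iic b).Finite := fun k =>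
    finite_zeros_inter_Iic (h₂ k) (hne k) (ha k)
  -- The induction also carries isolation: locally uniformly in `k`, no zero lies just above the
  -- n-th one. The next step needs this to keep the following zero away from the present curve.
  suffices H : ∀ n k, HasDerivAt (fun k => increasingEnum {E | F k E = 0} n)
      (-F₁ k (increasingEnum {E | F k E = 0} n) / F₂ k (increasingEnum {E | F k E = 0} n)) k ∧
      ∀ᶠ v : ℝ × ℝ in 𝓝 (k, increasingEnum {E | F k E = 0} n),
        increasingEnum {E | F v.1 E = 0} n < v.2 → F v.1 v.2 ≠ 0 from (H n k).1
  intro n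
  induction n with
  | zero =>
    intro k
    -- The constant curve `a`, below all zeros, serves as the predecessor of the first zero.
    refine hasDerivAt_next_zero h₁ h₂ c₁ c₂ c hne (α := fun _ => a)
      (N := fun k => increasingEnum {E | F k E = 0} 0) continuousAt_const (fun k => ?_) ?_
    · have hsub : {E | F k E = 0} ∩ Ioi a = {E | F k E = 0} :=
        inter_eq_left.2 fun E hE => not_le.1 fun h => ha k E h hE
      obtain ⟨E, hE, _⟩ := hunb k 0
      rw [hsub]
      exact isLeast_sInf_of_finite_inter_Iic ⟨E, hE⟩ (hfin k)
    · filter_upwards [c.continuousAt.eventually_ne (x := (k, a)) (ha k a le_rfl)] with v hv _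
      exact hv
  | succ n ih =>
    intro k
    exact hasDerivAt_next_zero h₁ h₂ c₁ c₂ c hne
      (α := fun k => increasingEnum {E | F k E = 0} n)
      (N := fun k => increasingEnum {E | F k E = 0} (n + 1)) (ih k).1.continuousAt
      (fun k => isLeast_sInf_inter_Ioi (hfin k) (hunb k) _) (ih k).2

end Branches

/-! ### The secular function -/

/-- The argument `√(2b) (x - k/b)` of the parabolic cylinder function. -/
def arg (b k x : ℝ) : ℝ := √(2 * b) * (x - k / b)

/-- The index `E/(2b) - 1/2` of the parabolic cylinder function. -/
def index (b E : ℝ) : ℝ := E / (2 * b) - 1 / 2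

/-- The solution of `w'' = ((b x - k)² - E) w` that decays at `+∞` (for `m = 0`). -/
def sol (m : ℕ) (b k E x : ℝ) : ℝ := weber m (arg b k x) (index b E)

/-- The derivative of `sol m b k E` in `x`. -/
def solDeriv (m : ℕ) (b k E x : ℝ) : ℝ := √(2 * b) * weberDeriv m (arg b k x) (index b E)

section Sol

variable {b : ℝ} (hb : 0 < b)

theorem hasDerivAt_arg_right (b k x : ℝ) : HasDerivAt (fun x => arg b k x) (√(2 * b)) x := by
  exact (((hasDerivAt_id x).sub_const (k / b)).const_mul (√(2 * b))).congr_deriv (mul_one _)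

theorem hasDerivAt_arg_left (b k x : ℝ) :
    HasDerivAt (fun k => arg b k x) (-(1 / b) * √(2 * b)) k := by
  refine ((((hasDerivAt_id k).div_const b).const_sub x).const_mul (√(2 * b))).congr_deriv ?_
  ring

theorem hasDerivAt_index (b E : ℝ) : HasDerivAt (fun E => index b E) (1 / (2 * b)) E :=
  ((hasDerivAt_id E).div_const (2 * b)).sub_const (1 / 2)

theorem hasDerivAt_sol (m : ℕ) (b k E x : ℝ) :
    HasDerivAt (fun x => sol m b k E x) (solDeriv m b k E x) x := by
  refine ((hasDerivAt_weber m _ _).comp x (hasDerivAt_arg_right b k x)).congr_deriv ?_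
  rw [solDeriv, mul_comm]

include hb in
theorem arg_sq_mul (k E x : ℝ) :
    2 * b * (arg b k x ^ 2 / 4 - index b E - 1 / 2) = (b * x - k) ^ 2 - E := by
  have h : √(2 * b) ^ 2 = 2 * b := Real.sq_sqrt (by positivity)
  simp only [arg, index, mul_pow, h]
  field_simp
  ring

include hb in
theorem hasDerivAt_solDeriv (k E x : ℝ) :
    HasDerivAt (fun x => solDeriv 0 b k E x) (((b * x - k) ^ 2 - E) * sol 0 b k E x) x := by
  have h : √(2 * b) * √(2 * b) = 2 * b := Real.mul_self_sqrt (by positivity)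
  refine (((hasDerivAt_weberDeriv 0 _ _).comp x (hasDerivAt_arg_right b k x)).const_mul
    (√(2 * b))).congr_deriv ?_
  rw [← arg_sq_mul hb, sol]
  push_cast
  linear_combination (arg b k x ^ 2 / 4 - index b E - 1 / 2) * weber 0 (arg b k x) (index b E) * h

theorem hasDerivAt_sol_momentum (b k E x : ℝ) :
    HasDerivAt (fun k => sol 0 b k E x) (-(1 / b) * solDeriv 0 b k E x) k := by
  refine ((hasDerivAt_weber 0 _ _).comp k (hasDerivAt_arg_left b k x)).congr_deriv ?_
  rw [solDeriv]
  ring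

include hb in
theorem hasDerivAt_solDeriv_momentum (k E x : ℝ) :
    HasDerivAt (fun k => solDeriv 0 b k E x)
      (-(1 / b) * (((b * x - k) ^ 2 - E) * sol 0 b k E x)) k := by
  have h : √(2 * b) * √(2 * b) = 2 * b := Real.mul_self_sqrt (by positivity)
  refine (((hasDerivAt_weberDeriv 0 _ _).comp k (hasDerivAt_arg_left b k x)).const_mul
    (√(2 * b))).congr_deriv ?_
  rw [← arg_sq_mul hb, sol]
  push_cast
  linear_combination -(1 / b) * (arg b k x ^ 2 / 4 - index b E - 1 / 2) *
    weber 0 (arg b k x) (index b E) * h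

theorem hasDerivAt_sol_energy (m : ℕ) (b k E x : ℝ) :
    HasDerivAt (fun E => sol m b k E x) (1 / (2 * b) * sol (m + 1) b k E x) E := by
  refine ((hasDerivAt_weber_index m _ _).comp E (hasDerivAt_index b E)).congr_deriv ?_
  rw [sol, mul_comm]

theorem hasDerivAt_solDeriv_energy (m : ℕ) (b k E x : ℝ) :
    HasDerivAt (fun E => solDeriv m b k E x) (1 / (2 * b) * solDeriv (m + 1) b k E x) E := by
  refine (((hasDerivAt_weberDeriv_index m _ _).comp E (hasDerivAt_index b E)).const_mul
    (√(2 * b))).congr_deriv ?_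
  rw [solDeriv]
  ring

theorem continuous_arg_index (b x : ℝ) :
    Continuous fun p : ℝ × ℝ => (arg b p.1 x, index b p.2) := by
  unfold arg index
  fun_prop

theorem continuous_sol (m : ℕ) (b x : ℝ) : Continuous fun p : ℝ × ℝ => sol m b p.1 p.2 x :=
  (continuous_weber m).comp (continuous_arg_index b x)

theorem continuous_solDeriv (m : ℕ) (b x : ℝ) :
    Continuous fun p : ℝ × ℝ => solDeriv m b p.1 p.2 x :=
  ((continuous_weberDeriv m).comp (continuous_arg_index b x)).const_mul _

include hb in
theorem sol_wronskian_energy_neg (k E x : ℝ) :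
    sol 1 b k E x * solDeriv 0 b k E x - solDeriv 1 b k E x * sol 0 b k E x < 0 := by
  have h := mul_neg_of_pos_of_neg (Real.sqrt_pos.2 (by positivity : 0 < 2 * b))
    (weber_wronskian_index_neg (arg b k x) (index b E))
  simp only [sol, solDeriv]
  linarith

include hb in
-- For `k ≤ 0` the minimum of the parabola is not to the right of `0`, so the argument at `x = 0` is
-- nonnegative and `weber_energy_pos` applies.
theorem sol_energy_pos {k : ℝ} (hk : k ≤ 0) (E : ℝ) :
    0 < solDeriv 0 b k E 0 ^ 2 + (E - k ^ 2) * sol 0 b k E 0 ^ 2 := by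
  have hz : 0 ≤ arg b k 0 := by
    have : k / b ≤ 0 := div_nonpos_of_nonpos_of_nonneg hk hb.le
    unfold arg
    exact mul_nonneg (Real.sqrt_nonneg _) (by linarith)
  have h := mul_pos (by positivity : 0 < 2 * b) (weber_energy_pos hz (index b E))
  have h1 := arg_sq_mul hb k E 0
  have h2 : √(2 * b) ^ 2 = 2 * b := Real.sq_sqrt (by positivity)
  rw [show E - k ^ 2 = -((b * 0 - k) ^ 2 - E) by ring, ← h1]
  simp only [sol, solDeriv, mul_pow, h2]
  linarith

include hb in
theorem sol_mul_solDeriv_neg (k : ℝ) {E : ℝ} (hE : E ≤ 0) (x : ℝ) :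
    sol 0 b k E x * solDeriv 0 b k E x < 0 := by
  have hν : index b E + 1 / 2 ≤ 0 := by
    unfold index
    have : E / (2 * b) ≤ 0 := div_nonpos_of_nonpos_of_nonneg hE (by positivity)
    linarith
  have h := mul_neg_of_pos_of_neg (Real.sqrt_pos.2 (by positivity : 0 < 2 * b))
    (weber_mul_weberDeriv_neg hν (arg b k x))
  simp only [sol, solDeriv]
  linarith

include hb in
theorem exists_sol_eq_zero (k x a : ℝ) : ∃ E, a < E ∧ sol 0 b k E x = 0 := by
  obtain ⟨ν, hν, h⟩ := exists_weber_eq_zero (arg b k x) (index b a)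
  refine ⟨2 * b * (ν + 1 / 2), ?_, ?_⟩
  · unfold index at hν
    have : a / (2 * b) < ν + 1 / 2 := by linarith
    rw [div_lt_iff₀ (by positivity)] at this
    linarith
  · have : index b (2 * b * (ν + 1 / 2)) = ν := by
      unfold index
      field_simp
      ring
    rw [sol, this, h]

end Sol

/-- The function whose zeros in `E` are the eigenvalues of the fibre operator: up to sign, the
Wronskian at `0` of the solutions that decay at `+∞` and at `-∞`. -/
def secular (bMinus bPlus k E : ℝ) : ℝ :=
  sol 0 bPlus k E 0 * solDeriv 0 bMinus (-k) E 0 + solDeriv 0 bPlus k E 0 * sol 0 bMinus (-k) E 0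

/-- The derivative of `secular` in `k`. -/
def secularMomentum (bMinus bPlus k E : ℝ) : ℝ :=
  (1 / bMinus - 1 / bPlus) * (solDeriv 0 bPlus k E 0 * solDeriv 0 bMinus (-k) E 0
    + (k ^ 2 - E) * (sol 0 bPlus k E 0 * sol 0 bMinus (-k) E 0))

/-- The derivative of `secular` in `E`. -/
def secularEnergy (bMinus bPlus k E : ℝ) : ℝ :=
  1 / (2 * bPlus) * (sol 1 bPlus k E 0 * solDeriv 0 bMinus (-k) E 0
    + solDeriv 1 bPlus k E 0 * sol 0 bMinus (-k) E 0) +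
  1 / (2 * bMinus) * (sol 0 bPlus k E 0 * solDeriv 1 bMinus (-k) E 0
    + solDeriv 0 bPlus k E 0 * sol 1 bMinus (-k) E 0)

/-! ### Derivatives, signs and existence of zeros of the secular function -/

section Secular

variable {bMinus bPlus : ℝ}

/-- Since `k` acts by translation, `∂_k` is `-(1/b) ∂_x` on each solution, with the opposite sign
for the reflected one. The second derivatives are removed by the equation at `x = 0`, where both
parabolas equal `k²`, and the factor `1/bMinus - 1/bPlus` remains. -/
theorem hasDerivAt_secular_momentum (hm : 0 < bMinus) (hp : 0 < bPlus) (k E : ℝ) :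
    HasDerivAt (fun k => secular bMinus bPlus k E) (secularMomentum bMinus bPlus k E) k := by
  have h1 := hasDerivAt_sol_momentum bPlus k E 0
  have h2 := hasDerivAt_solDeriv_momentum hp k E 0
  have h3 := (hasDerivAt_sol_momentum bMinus (-k) E 0).comp k (hasDerivAt_neg k)
  have h4 := (hasDerivAt_solDeriv_momentum hm (-k) E 0).comp k (hasDerivAt_neg k)
  refine ((h1.mul h4).add (h2.mul h3)).congr_deriv ?_
  simp only [secularMomentum, Function.comp_apply]
  ring

theorem hasDerivAt_secular_energy (bMinus bPlus k E : ℝ) :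
    HasDerivAt (fun E => secular bMinus bPlus k E) (secularEnergy bMinus bPlus k E) E := by
  refine (((hasDerivAt_sol_energy 0 bPlus k E 0).mul
    (hasDerivAt_solDeriv_energy 0 bMinus (-k) E 0)).add
    ((hasDerivAt_solDeriv_energy 0 bPlus k E 0).mul
    (hasDerivAt_sol_energy 0 bMinus (-k) E 0))).congr_deriv ?_
  simp only [secularEnergy]
  ring

theorem continuous_sol_neg (m : ℕ) (b x : ℝ) :
    Continuous fun p : ℝ × ℝ => sol m b (-p.1) p.2 x := by
  have h := (continuous_sol m b x).comp
    (by fun_prop : Continuous fun p : ℝ × ℝ => (-p.1, p.2))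
  simpa only [Function.comp_def] using h

theorem continuous_solDeriv_neg (m : ℕ) (b x : ℝ) :
    Continuous fun p : ℝ × ℝ => solDeriv m b (-p.1) p.2 x := by
  have h := (continuous_solDeriv m b x).comp
    (by fun_prop : Continuous fun p : ℝ × ℝ => (-p.1, p.2))
  simpa only [Function.comp_def] using h

theorem continuous_secular (bMinus bPlus : ℝ) :
    Continuous fun p : ℝ × ℝ => secular bMinus bPlus p.1 p.2 :=
  ((continuous_sol _ _ _).mul (continuous_solDeriv_neg _ _ _)).add
    ((continuous_solDeriv _ _ _).mul (continuous_sol_neg _ _ _))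

theorem continuous_secularMomentum (bMinus bPlus : ℝ) :
    Continuous fun p : ℝ × ℝ => secularMomentum bMinus bPlus p.1 p.2 :=
  (((continuous_solDeriv _ _ _).mul (continuous_solDeriv_neg _ _ _)).add
    ((by fun_prop : Continuous fun p : ℝ × ℝ => p.1 ^ 2 - p.2).mul
      ((continuous_sol _ _ _).mul (continuous_sol_neg _ _ _)))).const_mul _

theorem continuous_secularEnergy (bMinus bPlus : ℝ) :
    Continuous fun p : ℝ × ℝ => secularEnergy bMinus bPlus p.1 p.2 :=
  ((((continuous_sol _ _ _).mul (continuous_solDeriv_neg _ _ _)).add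
    ((continuous_solDeriv _ _ _).mul (continuous_sol_neg _ _ _))).const_mul _).add
  ((((continuous_sol _ _ _).mul (continuous_solDeriv_neg _ _ _)).add
    ((continuous_solDeriv _ _ _).mul (continuous_sol_neg _ _ _))).const_mul _)

/-- Two real vectors with vanishing determinant, both nonzero, are proportional. -/
theorem exists_proportional {p p' q q' : ℝ} (h : p * q' + p' * q = 0) (hp : p ≠ 0 ∨ p' ≠ 0)
    (hq : q ≠ 0 ∨ q' ≠ 0) : ∃ c : ℝ, c ≠ 0 ∧ q = c * p ∧ q' = -(c * p') := by
  rcases eq_or_ne p 0 with h0 | h0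
  · have hp' : p' ≠ 0 := hp.resolve_left (not_not.2 h0)
    have hq0 : q = 0 := by
      rw [h0, zero_mul, zero_add] at h
      exact (mul_eq_zero.1 h).resolve_left hp'
    have hq' : q' ≠ 0 := hq.resolve_left (not_not.2 hq0)
    refine ⟨-(q' / p'), neg_ne_zero.2 (div_ne_zero hq' hp'), by simp [hq0, h0], ?_⟩
    field_simp
  · have h1 : q' = -(q / p * p') := by
      field_simp
      linarith
    refine ⟨q / p, ?_, by field_simp, h1⟩
    rintro hc
    rw [hc, zero_mul, neg_zero] at h1
    have : q = 0 := by
      rcases div_eq_zero_iff.1 hc with h | h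
      · exact h
      · exact absurd h h0
    exact hq.elim (fun h => h this) (fun h => h h1)

/-- If both vanished, so would the Wronskian with the energy derivative, which is strictly negative.
-/
theorem sol_ne_zero_or {b : ℝ} (hb : 0 < b) (k E x : ℝ) :
    sol 0 b k E x ≠ 0 ∨ solDeriv 0 b k E x ≠ 0 := by
  by_contra! h
  have := sol_wronskian_energy_neg hb k E x
  rw [h.1, h.2] at this
  simp at this

theorem exists_sol_proportional (hm : 0 < bMinus) (hp : 0 < bPlus) {k E : ℝ}
    (h : secular bMinus bPlus k E = 0) : ∃ c : ℝ, c ≠ 0 ∧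
      sol 0 bMinus (-k) E 0 = c * sol 0 bPlus k E 0 ∧
      solDeriv 0 bMinus (-k) E 0 = -(c * solDeriv 0 bPlus k E 0) :=
  exists_proportional h (sol_ne_zero_or hp k E 0) (sol_ne_zero_or hm (-k) E 0)

/-- The Feynman–Hellmann sign at a zero of the secular function. -/
theorem secularMomentum_mul_secularEnergy_neg (hm : 0 < bMinus) (hlt : bMinus < bPlus) {k E : ℝ}
    (h : secular bMinus bPlus k E = 0) :
    secularMomentum bMinus bPlus k E * secularEnergy bMinus bPlus k E < 0 := by
  have hp : 0 < bPlus := hm.trans hlt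
  obtain ⟨c, hc, h1, h2⟩ := exists_sol_proportional hm hp h
  have hc2 : 0 < c ^ 2 := by positivity
  have hen : 0 < solDeriv 0 bPlus k E 0 ^ 2 + (E - k ^ 2) * sol 0 bPlus k E 0 ^ 2 := by
    -- The energy argument is run on the half-line along which the potential increases away from
    -- `0`; for `k ≥ 0` this is the left one, and proportionality costs a factor `c²`.
    rcases le_total k 0 with hk | hk
    · exact sol_energy_pos hp hk E
    · have := sol_energy_pos hm (neg_nonpos.2 hk) E
      rw [h1, h2] at this
      have h3 : 0 < c ^ 2 * (solDeriv 0 bPlus k E 0 ^ 2 + (E - k ^ 2) * sol 0 bPlus k E 0 ^ 2) := by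
        linarith
      exact pos_of_mul_pos_right h3 hc2.le
  have w1 := sol_wronskian_energy_neg hp k E 0
  have w2 := sol_wronskian_energy_neg hm (-k) E 0
  have hb : 0 < 1 / bMinus - 1 / bPlus := sub_pos.2 (one_div_lt_one_div_of_lt hm hlt)
  have e1 : secularMomentum bMinus bPlus k E = -c * ((1 / bMinus - 1 / bPlus) *
      (solDeriv 0 bPlus k E 0 ^ 2 + (E - k ^ 2) * sol 0 bPlus k E 0 ^ 2)) := by
    rw [secularMomentum, h1, h2]
    ring
  -- Multiplying by `c` turns each bracket, by the matching relations, into the Wronskian of a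
  -- single solution with its own energy derivative.
  have e2 : c * secularEnergy bMinus bPlus k E =
      1 / (2 * bPlus) * (c ^ 2 * -(sol 1 bPlus k E 0 * solDeriv 0 bPlus k E 0 -
        solDeriv 1 bPlus k E 0 * sol 0 bPlus k E 0)) +
      1 / (2 * bMinus) * -(sol 1 bMinus (-k) E 0 * solDeriv 0 bMinus (-k) E 0 -
        solDeriv 1 bMinus (-k) E 0 * sol 0 bMinus (-k) E 0) := by
    rw [secularEnergy, h1, h2]
    ring
  have e3 : 0 < c * secularEnergy bMinus bPlus k E := by
    rw [e2]
    have := neg_pos.2 w1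
    have := neg_pos.2 w2
    positivity
  rw [e1]
  have := mul_pos (mul_pos hb hen) e3
  linarith

/-- For `E ≤ 0` the square of each decaying solution strictly decreases toward its own infinity, so
the logarithmic derivatives at `0` have opposite signs and cannot match. -/
theorem secular_ne_zero_of_nonpos (hm : 0 < bMinus) (hp : 0 < bPlus) (k : ℝ) {E : ℝ} (hE : E ≤ 0) :
    secular bMinus bPlus k E ≠ 0 := by
  intro h
  obtain ⟨c, hc, h1, h2⟩ := exists_sol_proportional hm hp h
  have n1 := sol_mul_solDeriv_neg hp k hE 0
  have n2 := sol_mul_solDeriv_neg hm (-k) hE 0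
  rw [h1, h2] at n2
  have hc2 : 0 < c ^ 2 := by positivity
  nlinarith [mul_neg_of_pos_of_neg hc2 n1]

/-- A differentiable function does not have positive derivative at two zeros unless it has a zero
with nonpositive derivative between them. -/
theorem exists_zero_deriv_nonpos {f f' : ℝ → ℝ} (hf : ∀ x, HasDerivAt f (f' x) x) {a b : ℝ}
    (hab : a < b) (ha : f a = 0) (ha' : 0 < f' a) (hb : f b = 0) :
    ∃ x, a < x ∧ f x = 0 ∧ f' x ≤ 0 := by
  by_contra! hpos
  have hcont : Continuous f := continuous_iff_continuousAt.2 fun x => (hf x).continuousAt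
  have hright : ∀ᶠ x in 𝓝[>] a, 0 < f x := by
    have h := (hasDerivAt_iff_tendsto_slope.1 (hf a)).mono_left
      (nhdsWithin_mono a fun x (hx : a < x) => hx.ne')
    filter_upwards [h.eventually (Ioi_mem_nhds ha'), self_mem_nhdsWithin] with x hx hax
    rw [slope_def_field, ha, sub_zero] at hx
    exact (div_pos_iff_of_pos_right (sub_pos.2 hax)).1 hx
  obtain ⟨x₀, hx₀, hx₀a, hx₀b⟩ := (hright.and (Ioo_mem_nhdsGT hab)).exists
  set S := Icc x₀ b ∩ {x | f x = 0}
  have hScl : IsCompact S := isCompact_Icc.inter_right (isClosed_eq hcont continuous_const)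
  have hSne : S.Nonempty := ⟨b, ⟨hx₀b.le, le_rfl⟩, hb⟩
  have hc := hScl.sInf_mem hSne
  set c := sInf S
  have hc0 : f c = 0 := hc.2
  have hxc : x₀ < c := lt_of_le_of_ne hc.1.1 fun h => by rw [h, hc0] at hx₀; exact hx₀.false
  have hleft : ∀ᶠ x in 𝓝[<] c, f x < 0 := by
    have h := (hasDerivAt_iff_tendsto_slope.1 (hf c)).mono_left
      (nhdsWithin_mono c fun x (hx : x < c) => hx.ne)
    filter_upwards [h.eventually (Ioi_mem_nhds (hpos c (hx₀a.trans hxc) hc0)),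
      self_mem_nhdsWithin] with x hx hxc
    rw [slope_def_field, hc0, sub_zero] at hx
    have h1 := mul_neg_of_pos_of_neg hx (sub_neg.2 hxc)
    rwa [div_mul_cancel₀ _ (sub_neg.2 hxc).ne] at h1
  obtain ⟨x₁, hx₁, hx₁a, hx₁b⟩ := (hleft.and (Ioo_mem_nhdsLT hxc)).exists
  obtain ⟨y, hy, hy0⟩ := intermediate_value_Icc' hx₁a.le hcont.continuousOn
    (show (0 : ℝ) ∈ Icc (f x₁) (f x₀) from ⟨hx₁.le, hx₀.le⟩)
  have : c ≤ y := csInf_le hScl.bddBelow ⟨⟨hy.1, hy.2.trans (hx₁b.le.trans hc.1.2)⟩, hy0⟩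
  linarith [hy.2]

/-- At a zero in `E` of the product of the two solutions at `x = 0`, one of the factors vanishes; if
moreover `secular` is nonzero, its sign is opposite to that of the derivative of the product. A
constant sign of `secular` beyond `a` would thus make all these crossings go the same way, which two
zeros of the product forbid. -/
theorem exists_secular_eq_zero (hm : 0 < bMinus) (hp : 0 < bPlus) (k a : ℝ) :
    ∃ E ∈ {E | secular bMinus bPlus k E = 0}, a < E := by
  by_contra! hle
  have hne : ∀ E, a < E → secular bMinus bPlus k E ≠ 0 := fun E hE h => (hle E h).not_gt hE
  have hcont : Continuous fun E => secular bMinus bPlus k E :=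
    continuous_iff_continuousAt.2 fun E =>
      (hasDerivAt_secular_energy bMinus bPlus k E).continuousAt
  obtain ⟨σ, hσ⟩ : ∃ σ : ℝ, ∀ E ∈ Ioi a, 0 < σ * secular bMinus bPlus k E := by
    have hsign : (∀ E ∈ Ioi a, 0 < secular bMinus bPlus k E) ∨
        (∀ E ∈ Ioi a, secular bMinus bPlus k E < 0) := by
      by_contra! h
      obtain ⟨⟨x, hx, hx'⟩, y, hy, hy'⟩ := h
      obtain ⟨w, hw, hw'⟩ := isPreconnected_Ioi.intermediate_value hx hy hcont.continuousOn
        (show (0 : ℝ) ∈ Icc _ _ from ⟨hx', hy'⟩)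
      exact hne w hw hw'
    rcases hsign with h | h
    · exact ⟨1, fun ν hν => by simpa using h ν hν⟩
    · exact ⟨-1, fun ν hν => by simpa using h ν hν⟩
  obtain ⟨E₁, h1, h1'⟩ := exists_sol_eq_zero hp k 0 a
  obtain ⟨E₂, h2, h2'⟩ := exists_sol_eq_zero hp k 0 E₁
  have hf : ∀ E, HasDerivAt (fun E => -σ * (sol 0 bPlus k E 0 * sol 0 bMinus (-k) E 0))
      (-σ * (1 / (2 * bPlus) * sol 1 bPlus k E 0 * sol 0 bMinus (-k) E 0 +
        sol 0 bPlus k E 0 * (1 / (2 * bMinus) * sol 1 bMinus (-k) E 0))) E :=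
    fun E => ((hasDerivAt_sol_energy 0 bPlus k E 0).mul
      (hasDerivAt_sol_energy 0 bMinus (-k) E 0)).const_mul (-σ)
  have hpos : ∀ E, a < E → -σ * (sol 0 bPlus k E 0 * sol 0 bMinus (-k) E 0) = 0 →
      0 < -σ * (1 / (2 * bPlus) * sol 1 bPlus k E 0 * sol 0 bMinus (-k) E 0 +
        sol 0 bPlus k E 0 * (1 / (2 * bMinus) * sol 1 bMinus (-k) E 0)) := by
    intro E hE h0
    have hs := hσ E hE
    have hσ0 : σ ≠ 0 := by rintro rfl; simp at hs
    have w1 := sol_wronskian_energy_neg hp k E 0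
    have w2 := sol_wronskian_energy_neg hm (-k) E 0
    have hσ2 : 0 < σ ^ 2 := by positivity
    -- Multiplication by the positive quantity `σ * secular` reduces the claim to a square times a
    -- negated Wronskian.
    refine pos_of_mul_pos_left ?_ hs.le
    unfold secular at hs ⊢
    rcases mul_eq_zero.1 ((mul_eq_zero.1 h0).resolve_left (neg_ne_zero.2 hσ0)) with h | h
    · rw [h, zero_mul, zero_add] at hs
      have hq : sol 0 bMinus (-k) E 0 ≠ 0 := by rintro hq; simp [hq] at hs
      rw [h] at w1 ⊢
      have : 0 < 1 / (2 * bPlus) * (σ ^ 2 * sol 0 bMinus (-k) E 0 ^ 2 *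
          -(sol 1 bPlus k E 0 * solDeriv 0 bPlus k E 0 - solDeriv 1 bPlus k E 0 * 0)) := by
        have := neg_pos.2 w1
        positivity
      linarith
    · rw [h, mul_zero, add_zero] at hs
      have hq : sol 0 bPlus k E 0 ≠ 0 := by rintro hq; simp [hq] at hs
      rw [h] at w2 ⊢
      have : 0 < 1 / (2 * bMinus) * (σ ^ 2 * sol 0 bPlus k E 0 ^ 2 *
          -(sol 1 bMinus (-k) E 0 * solDeriv 0 bMinus (-k) E 0 -
            solDeriv 1 bMinus (-k) E 0 * 0)) := by
        have := neg_pos.2 w2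
        positivity
      linarith
  obtain ⟨E, hE, hE0, hE1⟩ := exists_zero_deriv_nonpos hf h2 (by rw [h1']; ring)
    (hpos E₁ h1 (by rw [h1']; ring)) (by rw [h2']; ring)
  exact (hpos E (h1.trans hE) hE0).not_ge hE1

end Secular

/-! ### Linear differential equations -/

section LinearODE

variable {X : Type*} [NormedAddCommGroup X] [NormedSpace ℝ X]

/-- The Picard iterates of `w' = A w`, `w 0 = w₀`. -/
def picardTerm (A : ℝ → X →L[ℝ] X) (w₀ : X) : ℕ → ℝ → X
  | 0 => fun _ => w₀
  | n + 1 => fun x => ∫ t in (0 : ℝ)..x, A t (picardTerm A w₀ n t)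

variable [CompleteSpace X] {A : ℝ → X →L[ℝ] X} (hA : Continuous A) (w₀ : X)

include hA

theorem continuous_picardTerm (n : ℕ) : Continuous (picardTerm A w₀ n) := by
  induction n with
  | zero => exact continuous_const
  | succ n ih =>
    refine continuous_iff_continuousAt.2 fun x => ?_
    exact ((hA.clm_apply ih).integral_hasStrictDerivAt 0 x).hasDerivAt.continuousAt

theorem hasDerivAt_picardTerm (n : ℕ) (x : ℝ) :
    HasDerivAt (picardTerm A w₀ (n + 1)) (A x (picardTerm A w₀ n x)) x :=
  ((hA.clm_apply (continuous_picardTerm hA w₀ n)).integral_hasStrictDerivAt 0 x).hasDerivAt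

/-- Iterated integration produces the factorial, so the Picard series converges on every bounded
interval without any restriction on its length. -/
theorem norm_picardTerm_le {R K : ℝ} (hK : ∀ t, |t| ≤ R → ‖A t‖ ≤ K) (n : ℕ) {x : ℝ}
    (hx : |x| ≤ R) : ‖picardTerm A w₀ n x‖ ≤ ‖w₀‖ * ((K * |x|) ^ n / n.factorial) := by
  have hK0 : 0 ≤ K := (norm_nonneg _).trans (hK x hx)
  induction n generalizing x with
  | zero => simp [picardTerm]
  | succ n ih =>
    have hle : ∀ t ∈ uIoc 0 x, ‖A t (picardTerm A w₀ n t)‖ ≤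
        K * ‖w₀‖ * K ^ n / n.factorial * |t - 0| ^ n := by
      intro t ht
      have ht' : |t| ≤ R := by
        have := abs_sub_left_of_mem_uIcc (uIoc_subset_uIcc ht)
        simp only [sub_zero] at this
        exact this.trans hx
      calc ‖A t (picardTerm A w₀ n t)‖ ≤ ‖A t‖ * ‖picardTerm A w₀ n t‖ := (A t).le_opNorm _
        _ ≤ K * (‖w₀‖ * ((K * |t|) ^ n / n.factorial)) := by
            gcongr
            · exact hK t ht'
            · exact ih ht'
        _ = _ := by rw [sub_zero]; ring
    calc ‖picardTerm A w₀ (n + 1) x‖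
        ≤ ∫ t in uIoc 0 x, ‖A t (picardTerm A w₀ n t)‖ :=
          intervalIntegral.norm_integral_le_integral_norm_uIoc
      _ ≤ ∫ t in uIoc 0 x, K * ‖w₀‖ * K ^ n / n.factorial * |t - 0| ^ n := by
          refine setIntegral_mono_on ?_ ?_ measurableSet_uIoc hle
          · have : Continuous fun t => ‖A t (picardTerm A w₀ n t)‖ :=
              (hA.clm_apply (continuous_picardTerm hA w₀ n)).norm
            exact this.integrableOn_uIoc
          · exact (by fun_prop : Continuous fun t : ℝ =>
              K * ‖w₀‖ * K ^ n / n.factorial * |t - 0| ^ n).integrableOn_uIoc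
      _ = _ := by
          rw [integral_const_mul, integral_pow_abs_sub_uIoc, sub_zero, Nat.factorial_succ]
          push_cast
          field_simp
          ring

/-- Global solvability of linear differential equations. -/
theorem exists_hasDerivAt_linear : ∃ w : ℝ → X, w 0 = w₀ ∧ ∀ x, HasDerivAt w (A x (w x)) x := by
  refine ⟨fun x => ∑' n, picardTerm A w₀ n x, ?_, fun x => ?_⟩
  · refine (tsum_eq_single 0 fun n hn => ?_).trans rfl
    obtain ⟨m, rfl⟩ := Nat.exists_eq_succ_of_ne_zero hn
    simp [picardTerm]
  · set R := |x| + 1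
    have hx : x ∈ Metric.ball (0 : ℝ) R := by simp [R]
    obtain ⟨K, hK⟩ := (isCompact_closedBall (0 : ℝ) R).exists_bound_of_continuousOn hA.continuousOn
    have hK' : ∀ t, |t| ≤ R → ‖A t‖ ≤ K := fun t ht => hK t (by simpa using ht)
    have hK0 : 0 ≤ K := (norm_nonneg _).trans (hK' x (by simp [R]))
    have hbound : ∀ n, ∀ y ∈ Metric.ball (0 : ℝ) R,
        ‖picardTerm A w₀ n y‖ ≤ ‖w₀‖ * ((K * R) ^ n / n.factorial) := by
      intro n y hy
      have hy' : |y| ≤ R := by simpa using (Metric.mem_ball.1 hy).le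
      exact (norm_picardTerm_le hA w₀ hK' n hy').trans (by gcongr)
    have hsum : Summable fun n : ℕ => ‖w₀‖ * ((K * R) ^ n / n.factorial) :=
      (Real.summable_pow_div_factorial _).mul_left _
    have hs : Summable fun n => picardTerm A w₀ n x :=
      hsum.of_norm_bounded fun n => hbound n x hx
    have hderiv : ∀ n, ∀ y ∈ Metric.ball (0 : ℝ) R,
        HasDerivAt (picardTerm A w₀ (n + 1)) (A y (picardTerm A w₀ n y)) y :=
      fun n y _ => hasDerivAt_picardTerm hA w₀ n y
    have hderiv_le : ∀ n, ∀ y ∈ Metric.ball (0 : ℝ) R,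
        ‖A y (picardTerm A w₀ n y)‖ ≤ K * (‖w₀‖ * ((K * R) ^ n / n.factorial)) := by
      intro n y hy
      refine ((A y).le_opNorm _).trans ?_
      have h1 := hK' y (by simpa using (Metric.mem_ball.1 hy).le)
      have h2 := hbound n y hy
      gcongr
    have key : HasDerivAt (fun z => ∑' n, picardTerm A w₀ (n + 1) z)
        (∑' n, A x (picardTerm A w₀ n x)) x :=
      hasDerivAt_tsum_of_isPreconnected (hsum.mul_left K) Metric.isOpen_ball
        (convex_ball (0 : ℝ) R).isPreconnected hderiv hderiv_le hx
        ((summable_nat_add_iff 1).2 hs) hx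
    rw [(A x).map_tsum hs]
    refine (key.const_add w₀).congr_of_eventuallyEq ?_
    filter_upwards [Metric.isOpen_ball.mem_nhds hx] with y hy
    exact (hsum.of_norm_bounded fun n => hbound n y hy).tsum_eq_zero_add

end LinearODE

/-- Used to continue a decaying half-line solution across `0` with prescribed Cauchy data; no
information on its growth on the other side is needed. -/
theorem exists_solution {Q : ℝ → ℝ} (hQ : Continuous Q) (a b : ℝ) :
    ∃ u u' : ℝ → ℝ, u 0 = a ∧ u' 0 = b ∧ (∀ x, HasDerivAt u (u' x) x) ∧
      ∀ x, HasDerivAt u' (Q x * u x) x := by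
  let A : ℝ → (ℝ × ℝ) →L[ℝ] (ℝ × ℝ) := fun x =>
    (ContinuousLinearMap.inl ℝ ℝ ℝ).comp (ContinuousLinearMap.snd ℝ ℝ ℝ) +
      Q x • (ContinuousLinearMap.inr ℝ ℝ ℝ).comp (ContinuousLinearMap.fst ℝ ℝ ℝ)
  have hA : Continuous A := continuous_const.add (hQ.smul continuous_const)
  obtain ⟨w, h0, hw⟩ := exists_hasDerivAt_linear hA (a, b)
  refine ⟨fun x => (w x).1, fun x => (w x).2, by simp [h0], by simp [h0], fun x => ?_, fun x => ?_⟩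
  · exact ((hasFDerivAt_fst (𝕜 := ℝ) (p := w x)).comp_hasDerivAt x (hw x)).congr_deriv
      (by simp [A])
  · exact ((hasFDerivAt_snd (𝕜 := ℝ) (p := w x)).comp_hasDerivAt x (hw x)).congr_deriv
      (by simp [A])

/-- `f` to the left of `0` and `g` from `0` on. -/
def glue (f g : ℝ → ℝ) (x : ℝ) : ℝ := if x < 0 then f x else g x

theorem glue_of_nonneg (f g : ℝ → ℝ) {x : ℝ} (hx : 0 ≤ x) : glue f g x = g x :=
  if_neg (not_lt.2 hx)

theorem glue_of_nonpos {f g : ℝ → ℝ} (h0 : f 0 = g 0) {x : ℝ} (hx : x ≤ 0) : glue f g x = f x := by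
  rcases hx.lt_or_eq with h | h
  · exact if_pos h
  · rw [h, glue_of_nonneg f g le_rfl, h0]

theorem hasDerivAt_glue {f g f' g' : ℝ → ℝ} (hf : ∀ x, x ≤ 0 → HasDerivAt f (f' x) x)
    (hg : ∀ x, 0 ≤ x → HasDerivAt g (g' x) x) (h0 : f 0 = g 0) (h0' : f' 0 = g' 0) (x : ℝ) :
    HasDerivAt (glue f g) (glue f' g' x) x := by
  rcases lt_trichotomy x 0 with h | h | h
  · rw [glue_of_nonpos h0' h.le]
    refine (hf x h.le).congr_of_eventuallyEq ?_
    filter_upwards [Iio_mem_nhds h] with y hy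
    exact glue_of_nonpos h0 (le_of_lt hy)
  · subst h
    rw [glue_of_nonneg _ _ le_rfl]
    have h1 : HasDerivWithinAt (glue f g) (g' 0) (Iic 0) 0 :=
      ((hf 0 le_rfl).congr_deriv h0').hasDerivWithinAt.congr (fun y hy => glue_of_nonpos h0 hy)
        (glue_of_nonpos h0 le_rfl)
    have h2 : HasDerivWithinAt (glue f g) (g' 0) (Ici 0) 0 :=
      (hg 0 le_rfl).hasDerivWithinAt.congr (fun y hy => glue_of_nonneg f g hy)
        (glue_of_nonneg f g le_rfl)
    simpa [Iic_union_Ici, hasDerivWithinAt_univ] using h1.union h2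
  · rw [glue_of_nonneg _ _ h.le]
    refine (hg x h.le).congr_of_eventuallyEq ?_
    filter_upwards [Ioi_mem_nhds h] with y hy
    exact glue_of_nonneg f g (le_of_lt hy)

/-- Continuous functions that are `o(1/x)` at `±∞` are square integrable. -/
theorem memLp_two_of_tendsto {f : ℝ → ℝ} (hf : Continuous f)
    (htop : Tendsto (fun x => x * f x) atTop (𝓝 0))
    (hbot : Tendsto (fun x => x * f x) atBot (𝓝 0)) : MemLp f 2 := by
  rw [memLp_two_iff_integrable_sq hf.aestronglyMeasurable]
  have key : ∀ x : ℝ, |x * f x| < 1 → 1 ≤ |x| → ‖f x ^ 2‖ ≤ 2 * ‖(1 + x ^ 2)⁻¹‖ := by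
    intro x h1 h2
    rw [Real.norm_of_nonneg (sq_nonneg _), Real.norm_of_nonneg (by positivity),
      ← div_eq_mul_inv, le_div_iff₀ (by positivity)]
    have h3 : (x * f x) ^ 2 < 1 := by
      rw [← sq_abs]
      exact pow_lt_one₀ (abs_nonneg _) h1 two_ne_zero
    have h4 : 1 ≤ x ^ 2 := by rw [← sq_abs]; exact one_le_pow₀ h2
    nlinarith [sq_nonneg (f x)]
  have hev : ∀ {l : Filter ℝ}, Tendsto (fun x => x * f x) l (𝓝 0) →
      ∀ᶠ x in l, |x * f x| < 1 := fun h => by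
    have := h.abs
    rw [abs_zero] at this
    exact this.eventually (Iio_mem_nhds one_pos)
  refine (hf.pow 2).locallyIntegrable.integrable_of_isBigO_atBot_atTop
    (g := fun x : ℝ => (1 + x ^ 2)⁻¹) (g' := fun x : ℝ => (1 + x ^ 2)⁻¹) ?_
    (integrable_inv_one_add_sq.integrableAtFilter _) ?_
    (integrable_inv_one_add_sq.integrableAtFilter _)
  · refine Asymptotics.IsBigO.of_bound 2 ?_
    filter_upwards [hev hbot, eventually_le_atBot (-1)] with x h1 h2
    exact key x h1 (by rw [abs_of_nonpos (by linarith)]; linarith)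
  · refine Asymptotics.IsBigO.of_bound 2 ?_
    filter_upwards [hev htop, eventually_ge_atTop 1] with x h1 h2
    exact key x h1 (by rw [abs_of_nonneg (by linarith)]; linarith)

/-! ### Weak eigenfunctions -/

/-- `u` solves `-u'' + V(·,k) u = E u` in the sense of distributions. -/
def IsWeakSolution (bMinus bPlus k E : ℝ) (u : L2) : Prop :=
  ∀ φ : ℝ → ℝ, ContDiff ℝ ∞ φ → HasCompactSupport φ →
    ∫ x, (applyFormal bMinus bPlus k φ x - E * φ x) • u x = 0

section WeakSolution

variable {bMinus bPlus k E : ℝ} {u : L2}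

theorem mem_fiberGraph_smul_iff :
    (u, (E : ℂ) • u) ∈ fiberGraph bMinus bPlus k ↔ IsWeakSolution bMinus bPlus k E u := by
  refine forall_congr' fun φ => forall_congr' fun hφ => forall_congr' fun hc => ?_
  have h1 : ∫ x, φ x • ((E : ℂ) • u : L2) x = ∫ x, (E * φ x) • u x := by
    refine integral_congr_ae ?_
    filter_upwards [Lp.coeFn_smul (E : ℂ) u] with x hx
    rw [hx, Pi.smul_apply, Complex.coe_smul, smul_smul, mul_comm]
  have h2 : ∫ x, (applyFormal bMinus bPlus k φ x - E * φ x) • u x =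
      (∫ x, applyFormal bMinus bPlus k φ x • u x) - ∫ x, (E * φ x) • u x := by
    rw [← integral_sub (integrable_test_smul (applyFormal_continuous bMinus bPlus k hφ)
      (applyFormal_hasCompactSupport bMinus bPlus k hc) u)
      (integrable_test_smul (hφ.continuous.const_mul E) (hc.mul_left) u)]
    exact integral_congr_ae (ae_of_all _ fun x => sub_smul _ _ _)
  rw [h2, sub_eq_zero]
  exact ⟨fun h => h.trans h1, fun h => h.trans h1.symm⟩

theorem mem_eigenvalues_iff :
    E ∈ eigenvalues bMinus bPlus k ↔ ∃ u : L2, u ≠ 0 ∧ IsWeakSolution bMinus bPlus k E u := by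
  constructor
  · rintro ⟨ψ, hψ, h⟩
    refine ⟨ψ, fun h0 => hψ (Subtype.ext h0), mem_fiberGraph_smul_iff.1 ?_⟩
    rw [← fiberOp_graph, ← h]
    exact LinearPMap.mem_graph _ ψ
  · rintro ⟨u, hu, h⟩
    have hg := mem_fiberGraph_smul_iff.2 h
    rw [← fiberOp_graph, LinearPMap.mem_graph_iff] at hg
    obtain ⟨ψ, h1, h2⟩ := hg
    simp only at h1 h2
    refine ⟨ψ, ?_, by rw [h2, h1]⟩
    rintro rfl
    exact hu h1.symm

/-- Twice continuously differentiable test functions suffice. -/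
theorem IsWeakSolution.integral_eq_zero_of_contDiff_two (hu : IsWeakSolution bMinus bPlus k E u)
    {φ : ℝ → ℝ} (hφ : ContDiff ℝ 2 φ) (hc : HasCompactSupport φ) :
    ∫ x, (applyFormal bMinus bPlus k φ x - E * φ x) • u x = 0 := by
  have hφ' : ContDiff ℝ 1 (deriv φ) := by
    have : ContDiff ℝ (1 + 1) φ := by simpa [one_add_one_eq_two] using hφ
    exact (contDiff_succ_iff_deriv.1 this).2.2
  have hφ1 : ContDiff ℝ 1 φ := hφ.of_le one_le_two
  have hφ'' : Continuous (deriv (deriv φ)) := hφ'.continuous_deriv le_rfl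
  have hV := continuous_potential bMinus bPlus k
  obtain ⟨R, hR⟩ := hc.isCompact.isBounded.subset_closedBall (0 : ℝ)
  obtain ⟨B, hB⟩ := (isCompact_closedBall (0 : ℝ) (R + 1)).exists_bound_of_continuousOn
    (f := fun x => potential bMinus bPlus k x - E) (by fun_prop)
  have hLc : Continuous fun x => applyFormal bMinus bPlus k φ x - E * φ x := by
    unfold applyFormal
    have := hφ.continuous
    fun_prop
  have hLs : HasCompactSupport fun x => applyFormal bMinus bPlus k φ x - E * φ x :=
    (applyFormal_hasCompactSupport bMinus bPlus k hc).sub (hc.mul_left)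
  have huS : IntegrableOn (fun x => ‖u x‖) (Metric.closedBall (0 : ℝ) (R + 1)) :=
    (((Lp.memLp u).locallyIntegrable (by norm_num)).integrableOn_isCompact
      (isCompact_closedBall _ _)).norm
  set I := ∫ x in Metric.closedBall (0 : ℝ) (R + 1), ‖u x‖
  have hI : 0 ≤ I := integral_nonneg fun _ => norm_nonneg _
  -- The test function is mollified. The error involves only `φ` and `φ''`, which are uniformly
  -- approximated on a fixed ball where the coefficient `V - E` is bounded by `B`.
  suffices H : ∀ ε : ℝ, 0 < ε →
      ‖∫ x, (applyFormal bMinus bPlus k φ x - E * φ x) • u x‖ ≤ ε * ((1 + |B|) * I) by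
    rw [← norm_le_zero_iff]
    refine ge_of_tendsto (x := 𝓝[>] (0 : ℝ)) (f := fun ε => ε * ((1 + |B|) * I)) ?_ ?_
    · have : Tendsto (fun ε : ℝ => ε * ((1 + |B|) * I)) (𝓝 0) (𝓝 (0 * ((1 + |B|) * I))) :=
        tendsto_id.mul_const _
      rw [zero_mul] at this
      exact this.mono_left nhdsWithin_le_nhds
    · filter_upwards [self_mem_nhdsWithin] with ε hε using H ε hε
  intro ε hε
  obtain ⟨δ₁, hδ₁, h₁⟩ := Metric.uniformContinuous_iff.1
    (hc.uniformContinuous_of_continuous hφ.continuous) ε hε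
  obtain ⟨δ₂, hδ₂, h₂⟩ := Metric.uniformContinuous_iff.1
    (hc.deriv.deriv.uniformContinuous_of_continuous hφ'') ε hε
  set δ := min 1 (min δ₁ δ₂)
  -- The cap `δ ≤ 1` keeps the mollified function supported in the ball of radius `R + 1`.
  have hδ : 0 < δ := by positivity
  have hδ1 : δ ≤ 1 := min_le_left _ _
  have hδδ₁ : δ ≤ δ₁ := (min_le_right _ _).trans (min_le_left _ _)
  have hδδ₂ : δ ≤ δ₂ := (min_le_right _ _).trans (min_le_right _ _)
  let η : ContDiffBump (0 : ℝ) := ⟨δ / 2, δ, by positivity, by linarith⟩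
  have hηi : LocallyIntegrable (η.normed volume) :=
    η.integrable_normed.locallyIntegrable
  set L := ContinuousLinearMap.lsmul ℝ ℝ (E := ℝ)
  set χ : ℝ → ℝ := convolution (η.normed volume) φ L volume
  have hχ : ContDiff ℝ ∞ χ := η.hasCompactSupport_normed.contDiff_convolution_left L
    (n := ⊤) η.contDiff_normed hφ.continuous.locallyIntegrable
  have hχc : HasCompactSupport χ := η.hasCompactSupport_normed.convolution L hc
  have hd1 : deriv χ = convolution (η.normed volume) (deriv φ) L volume :=
    funext fun x => (hc.hasDerivAt_convolution_right L hηi hφ1 x).deriv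
  have hd2 : deriv (deriv χ) = convolution (η.normed volume) (deriv (deriv φ)) L volume := by
    rw [hd1]
    exact funext fun x => (hc.deriv.hasDerivAt_convolution_right L hηi hφ' x).deriv
  have hb0 : ∀ x, |χ x - φ x| ≤ ε := fun x =>
    η.dist_normed_convolution_le hφ.continuous.aestronglyMeasurable
      fun y hy => (h₁ (lt_of_lt_of_le hy hδδ₁)).le
  have hb2 : ∀ x, |deriv (deriv χ) x - deriv (deriv φ) x| ≤ ε := fun x => by
    rw [hd2]
    exact η.dist_normed_convolution_le hφ''.aestronglyMeasurable
      fun y hy => (h₂ (lt_of_lt_of_le hy hδδ₂)).le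
  have hφS : ∀ x, x ∉ Metric.closedBall (0 : ℝ) (R + 1) → x ∉ tsupport φ := fun x hx h =>
    hx (Metric.closedBall_subset_closedBall (by linarith) (hR h))
  have hχsupp : tsupport χ ⊆ Metric.closedBall (0 : ℝ) (R + 1) := by
    refine closure_minimal ((support_convolution_subset L).trans ?_) Metric.isClosed_closedBall
    rw [η.support_normed_eq]
    rintro _ ⟨y, hy, z, hz, rfl⟩
    have hy' : |y| < δ := by simpa using hy
    have hz' : |z| ≤ R := by simpa using hR (subset_tsupport _ hz)
    rw [mem_closedBall_zero_iff, Real.norm_eq_abs]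
    exact (abs_add_le y z).trans (by linarith)
  have hzero : ∀ f : ℝ → ℝ, ∀ x, x ∉ tsupport f →
      applyFormal bMinus bPlus k f x - E * f x = 0 := by
    intro f x hx
    have e0 : f x = 0 := image_eq_zero_of_notMem_tsupport hx
    have e2 : deriv (deriv f) x = 0 := by
      refine image_eq_zero_of_notMem_tsupport fun h => hx ?_
      exact (tsupport_deriv_subset (𝕜 := ℝ)) ((tsupport_deriv_subset (𝕜 := ℝ)) h)
    simp [applyFormal, e0, e2]
  have hχLc : Continuous fun x => applyFormal bMinus bPlus k χ x - E * χ x :=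
    (applyFormal_continuous bMinus bPlus k hχ).sub (hχ.continuous.const_mul E)
  have hχLs : HasCompactSupport fun x => applyFormal bMinus bPlus k χ x - E * χ x :=
    (applyFormal_hasCompactSupport bMinus bPlus k hχc).sub (hχc.mul_left)
  rw [← sub_zero (∫ x, (applyFormal bMinus bPlus k φ x - E * φ x) • u x), ← hu χ hχ hχc,
    ← integral_sub (integrable_test_smul hLc hLs u) (integrable_test_smul hχLc hχLs u),
    ← setIntegral_eq_integral_of_forall_compl_eq_zero
      (s := Metric.closedBall (0 : ℝ) (R + 1)) (fun x hx => by
        rw [hzero φ x (hφS x hx), hzero χ x fun h => hx (hχsupp h), sub_self]),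
    show ε * ((1 + |B|) * I) = ∫ x in Metric.closedBall (0 : ℝ) (R + 1),
      ε * (1 + |B|) * ‖u x‖ by rw [integral_const_mul]; ring]
  refine norm_integral_le_of_norm_le (huS.const_mul _) ?_
  filter_upwards [ae_restrict_mem measurableSet_closedBall] with x hx
  rw [← sub_smul, norm_smul]
  gcongr
  have hBx : |potential bMinus bPlus k x - E| ≤ |B| := (hB x hx).trans (le_abs_self B)
  rw [Real.norm_eq_abs, show applyFormal bMinus bPlus k φ x - E * φ x -
    (applyFormal bMinus bPlus k χ x - E * χ x) =
      (deriv (deriv χ) x - deriv (deriv φ) x) -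
        (potential bMinus bPlus k x - E) * (χ x - φ x) by unfold applyFormal; ring]
  refine (abs_sub _ _).trans ?_
  rw [abs_mul]
  have := hb0 x
  have := hb2 x
  calc _ ≤ ε + |B| * ε := by gcongr
    _ = _ := by ring

end WeakSolution

/-! ### Test functions without compact support -/

section Cutoff

variable {bMinus bPlus k E : ℝ} {u : L2} {φ φ₁ φ₂ : ℝ → ℝ}

theorem contDiff_two_of_hasDerivAt (h₁ : ∀ x, HasDerivAt φ (φ₁ x) x)
    (h₂ : ∀ x, HasDerivAt φ₁ (φ₂ x) x) (hc : Continuous φ₂) : ContDiff ℝ 2 φ := by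
  have e1 : deriv φ = φ₁ := funext fun x => (h₁ x).deriv
  have e2 : deriv φ₁ = φ₂ := funext fun x => (h₂ x).deriv
  have c1 : ContDiff ℝ 1 φ₁ := contDiff_one_iff_deriv.2
    ⟨fun x => (h₂ x).differentiableAt, by rwa [e2]⟩
  have : ContDiff ℝ (1 + 1) φ := contDiff_succ_iff_deriv.2
    ⟨fun x => (h₁ x).differentiableAt, by simp, by rwa [e1]⟩
  simpa [one_add_one_eq_two] using this

theorem integrable_mul_norm {g : ℝ → ℝ} (hg : MemLp g 2) (u : L2) :
    Integrable fun x => |g x| * ‖u x‖ :=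
  hg.norm.integrable_mul (Lp.memLp u).norm

/-- Square-integrable test functions whose image has compact support are admissible. -/
theorem IsWeakSolution.integral_eq_zero_of_memLp (hu : IsWeakSolution bMinus bPlus k E u)
    (h₁ : ∀ x, HasDerivAt φ (φ₁ x) x) (h₂ : ∀ x, HasDerivAt φ₁ (φ₂ x) x) (hc : Continuous φ₂)
    (hφ : MemLp φ 2) (hφ₁ : MemLp φ₁ 2) {f : ℝ → ℝ} (hfc : Continuous f)
    (hf : ∀ x, f x = -φ₂ x + (potential bMinus bPlus k x - E) * φ x) (hfs : HasCompactSupport f) :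
    ∫ x, f x • u x = 0 := by
  have hφ2 := contDiff_two_of_hasDerivAt h₁ h₂ hc
  have hφc := hφ2.continuous
  have hφ₁c : Continuous φ₁ := continuous_iff_continuousAt.2 fun x => (h₂ x).continuousAt
  let χ : ContDiffBump (0 : ℝ) := ⟨1, 2, one_pos, one_lt_two⟩
  have hχ : ContDiff ℝ ∞ χ := χ.contDiff
  have hχ' : ContDiff ℝ ∞ (deriv χ) := (contDiff_infty_iff_deriv.1 hχ).2
  have hχ'' : ContDiff ℝ ∞ (deriv (deriv χ)) := (contDiff_infty_iff_deriv.1 hχ').2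
  have hχc : HasCompactSupport χ := χ.hasCompactSupport
  obtain ⟨C₁, hC₁⟩ := hχc.deriv.exists_bound_of_continuous hχ'.continuous
  obtain ⟨C₂, hC₂⟩ := hχc.deriv.deriv.exists_bound_of_continuous hχ''.continuous
  obtain ⟨R, hR⟩ := hfs.isCompact.isBounded.subset_closedBall (0 : ℝ)
  set M := ∫ x, (2 * |C₁| * (|φ₁ x| * ‖u x‖) + |C₂| * (|φ x| * ‖u x‖))
  have hint : Integrable fun x => 2 * |C₁| * (|φ₁ x| * ‖u x‖) + |C₂| * (|φ x| * ‖u x‖) :=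
    ((integrable_mul_norm hφ₁ u).const_mul _).add ((integrable_mul_norm hφ u).const_mul _)
  -- The test function is cut off by `χ (t x)`. The condition `t |R| ≤ 1` makes the cutoff equal to
  -- `1` on the support of `f`, and every commutator term carries a factor `t` or `t² ≤ t`.
  suffices H : ∀ t : ℝ, 0 < t → t ≤ 1 → t * |R| ≤ 1 → ‖∫ x, f x • u x‖ ≤ t * M by
    rw [← norm_le_zero_iff]
    refine ge_of_tendsto (x := 𝓝[>] (0 : ℝ)) (f := fun t => t * M) ?_ ?_
    · have : Tendsto (fun t : ℝ => t * M) (𝓝 0) (𝓝 (0 * M)) := tendsto_id.mul_const _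
      rw [zero_mul] at this
      exact this.mono_left nhdsWithin_le_nhds
    · have h1 : ∀ᶠ t : ℝ in 𝓝 0, t * |R| < 1 := by
        have : Tendsto (fun t : ℝ => t * |R|) (𝓝 0) (𝓝 (0 * |R|)) := tendsto_id.mul_const _
        rw [zero_mul] at this
        exact this.eventually (Iio_mem_nhds one_pos)
      filter_upwards [self_mem_nhdsWithin, nhdsWithin_le_nhds (Iio_mem_nhds one_pos),
        nhdsWithin_le_nhds h1] with t h1 h2 h3
      exact H t h1 (le_of_lt h2) h3.le
  intro t ht ht1 htR
  have hmul : ∀ x, HasDerivAt (fun x : ℝ => t * x) t x := fun x => by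
    simpa using (hasDerivAt_id x).const_mul t
  have d0 : ∀ x, HasDerivAt (fun x => χ (t * x)) (deriv χ (t * x) * t) x := fun x =>
    (hχ.differentiable (by simp) (t * x)).hasDerivAt.comp x (hmul x)
  have d1 : ∀ x, HasDerivAt (fun x => deriv χ (t * x)) (deriv (deriv χ) (t * x) * t) x := fun x =>
    (hχ'.differentiable (by simp) (t * x)).hasDerivAt.comp x (hmul x)
  set ψ : ℝ → ℝ := fun x => χ (t * x) * φ x
  have e1 : deriv ψ = fun x => deriv χ (t * x) * t * φ x + χ (t * x) * φ₁ x :=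
    funext fun x => ((d0 x).mul (h₁ x)).deriv
  have e2 : ∀ x, deriv (deriv ψ) x = (deriv (deriv χ) (t * x) * t * t * φ x +
      deriv χ (t * x) * t * φ₁ x) + (deriv χ (t * x) * t * φ₁ x + χ (t * x) * φ₂ x) := by
    intro x
    rw [e1]
    exact ((((d1 x).mul_const t).mul (h₁ x)).add ((d0 x).mul (h₂ x))).deriv
  have hψ : ContDiff ℝ 2 ψ := by
    have : ContDiff ℝ 2 fun x : ℝ => χ (t * x) :=
      χ.contDiff.comp (contDiff_const.mul contDiff_id)
    exact this.mul hφ2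
  have hχt : HasCompactSupport fun x : ℝ => χ (t * x) := by
    simpa using hχc.comp_smul ht.ne'
  have hψc : HasCompactSupport ψ := hχt.mul_right
  have h0 := hu.integral_eq_zero_of_contDiff_two hψ hψc
  have hfχ : ∀ x, χ (t * x) * f x = f x := by
    intro x
    by_cases hx : x ∈ tsupport f
    · have hxR : |x| ≤ R := by simpa using hR hx
      have : t * x ∈ Metric.closedBall (0 : ℝ) χ.rIn := by
        rw [mem_closedBall_zero_iff, Real.norm_eq_abs, abs_mul, abs_of_pos ht]
        exact (mul_le_mul_of_nonneg_left (hxR.trans (le_abs_self R)) ht.le).trans htR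
      rw [χ.one_of_mem_closedBall this, one_mul]
    · rw [image_eq_zero_of_notMem_tsupport hx, mul_zero]
  have hψL : ∀ x, applyFormal bMinus bPlus k ψ x - E * ψ x =
      f x - (2 * t * deriv χ (t * x) * φ₁ x + t ^ 2 * deriv (deriv χ) (t * x) * φ x) := by
    intro x
    rw [← hfχ x, hf x, applyFormal, e2]
    simp only [ψ]
    ring
  set g : ℝ → ℝ := fun x =>
    2 * t * deriv χ (t * x) * φ₁ x + t ^ 2 * deriv (deriv χ) (t * x) * φ x
  have hgc : Continuous g := by
    have := hχ'.continuous
    have := hχ''.continuous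
    fun_prop
  have hgs : HasCompactSupport g := by
    have k1 : HasCompactSupport fun x : ℝ => deriv χ (t * x) := by
      simpa using hχc.deriv.comp_smul ht.ne'
    have k2 : HasCompactSupport fun x : ℝ => deriv (deriv χ) (t * x) := by
      simpa using hχc.deriv.deriv.comp_smul ht.ne'
    exact (k1.mul_left.mul_right).add (k2.mul_left.mul_right)
  simp only [hψL, sub_smul] at h0
  rw [integral_sub (integrable_test_smul hfc hfs u) (integrable_test_smul hgc hgs u),
    sub_eq_zero] at h0
  rw [h0, ← integral_const_mul]
  refine norm_integral_le_of_norm_le (hint.const_mul t) (ae_of_all _ fun x => ?_)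
  rw [norm_smul, Real.norm_eq_abs]
  have b1 : |deriv χ (t * x)| ≤ |C₁| := (hC₁ _).trans (le_abs_self _)
  have b2 : |deriv (deriv χ) (t * x)| ≤ |C₂| := (hC₂ _).trans (le_abs_self _)
  have b3 : |g x| ≤ 2 * t * |C₁| * |φ₁ x| + t * |C₂| * |φ x| := by
    refine (abs_add_le _ _).trans ?_
    simp only [abs_mul, abs_two, abs_of_pos ht, abs_pow]
    have : t ^ 2 ≤ t := by nlinarith
    gcongr
  calc |g x| * ‖u x‖ ≤ (2 * t * |C₁| * |φ₁ x| + t * |C₂| * |φ x|) * ‖u x‖ := by gcongr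
    _ = _ := by ring

end Cutoff

/-! ### Eigenvalues are the zeros of the secular function -/

section Eigenvalues

variable {bMinus bPlus k E : ℝ}

theorem potential_of_nonneg {x : ℝ} (hx : 0 ≤ x) :
    potential bMinus bPlus k x = (bPlus * x - k) ^ 2 := by
  rw [potential, beta_eq, if_neg (not_lt.2 hx)]
  ring

theorem potential_of_nonpos {x : ℝ} (hx : x ≤ 0) :
    potential bMinus bPlus k x = (bMinus * x - k) ^ 2 := by
  rcases hx.lt_or_eq with h | h
  · rw [potential, beta_eq, if_pos h]
    ring
  · rw [h, potential_of_nonneg le_rfl]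
    ring

theorem tendsto_arg {b : ℝ} (hb : 0 < b) (k : ℝ) : Tendsto (arg b k) atTop atTop :=
  (tendsto_atTop_add_const_right _ (-(k / b)) tendsto_id).const_mul_atTop
    (Real.sqrt_pos.2 (by positivity))

theorem tendsto_mul_sol {b : ℝ} (hb : 0 < b) (k E : ℝ) :
    Tendsto (fun x => x * sol 0 b k E x) atTop (𝓝 0) := by
  have hs : √(2 * b) ≠ 0 := (Real.sqrt_pos.2 (by positivity)).ne'
  have h1 := ((tendsto_pow_mul_weber 1 0 (index b E)).comp (tendsto_arg hb k)).div_const (√(2 * b))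
  have h2 := ((tendsto_weber 0 (index b E)).comp (tendsto_arg hb k)).const_mul (k / b)
  have h3 := h1.add h2
  rw [zero_div, mul_zero, add_zero] at h3
  refine h3.congr fun x => ?_
  simp only [Function.comp_apply, sol, arg]
  field_simp
  ring

theorem tendsto_mul_solDeriv {b : ℝ} (hb : 0 < b) (k E : ℝ) :
    Tendsto (fun x => x * solDeriv 0 b k E x) atTop (𝓝 0) := by
  have hs : √(2 * b) ≠ 0 := (Real.sqrt_pos.2 (by positivity)).ne'
  have h1 := (tendsto_pow_mul_weberDeriv 1 0 (index b E)).comp (tendsto_arg hb k)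
  have h2 := ((tendsto_weberDeriv 0 (index b E)).comp (tendsto_arg hb k)).const_mul
    (√(2 * b) * (k / b))
  have h3 := h1.add h2
  rw [mul_zero, add_zero] at h3
  refine h3.congr fun x => ?_
  simp only [Function.comp_apply, solDeriv, arg]
  ring

theorem tendsto_mul_sol_neg {b : ℝ} (hb : 0 < b) (k E : ℝ) :
    Tendsto (fun x => x * sol 0 b k E (-x)) atBot (𝓝 0) := by
  have := ((tendsto_mul_sol hb k E).comp tendsto_neg_atBot_atTop).neg
  rw [neg_zero] at this
  refine this.congr fun x => ?_
  simp

theorem tendsto_mul_solDeriv_neg {b : ℝ} (hb : 0 < b) (k E : ℝ) :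
    Tendsto (fun x => x * -solDeriv 0 b k E (-x)) atBot (𝓝 0) := by
  have := (tendsto_mul_solDeriv hb k E).comp tendsto_neg_atBot_atTop
  refine this.congr fun x => ?_
  simp

theorem hasDerivAt_sol_neg (b k E x : ℝ) :
    HasDerivAt (fun x => sol 0 b k E (-x)) (-solDeriv 0 b k E (-x)) x := by
  refine ((hasDerivAt_sol 0 b k E (-x)).comp x (hasDerivAt_neg x)).congr_deriv ?_
  ring

theorem hasDerivAt_solDeriv_neg {b : ℝ} (hb : 0 < b) (k E x : ℝ) :
    HasDerivAt (fun x => -solDeriv 0 b (-k) E (-x))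
      (((b * x - k) ^ 2 - E) * sol 0 b (-k) E (-x)) x := by
  refine ((hasDerivAt_solDeriv hb (-k) E (-x)).comp x (hasDerivAt_neg x)).neg.congr_deriv ?_
  ring

/-- Vanishing of the Wronskian lets the two decaying solutions be glued at `0` to a classical
solution on the whole line, square integrable by its decay. -/
theorem mem_eigenvalues_of_secular_eq_zero (hm : 0 < bMinus) (hp : 0 < bPlus)
    (h : secular bMinus bPlus k E = 0) : E ∈ eigenvalues bMinus bPlus k := by
  obtain ⟨c, hc, e0, e1⟩ := exists_sol_proportional hm hp h
  set ψ := glue (fun x => sol 0 bMinus (-k) E (-x)) (fun x => c * sol 0 bPlus k E x)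
  set ψ₁ := glue (fun x => -solDeriv 0 bMinus (-k) E (-x)) (fun x => c * solDeriv 0 bPlus k E x)
  have m0 : sol 0 bMinus (-k) E (-0) = c * sol 0 bPlus k E 0 := by rw [neg_zero, e0]
  have m1 : -solDeriv 0 bMinus (-k) E (-0) = c * solDeriv 0 bPlus k E 0 := by
    rw [neg_zero, e1, neg_neg]
  have hψ : ∀ x, HasDerivAt ψ (ψ₁ x) x :=
    hasDerivAt_glue (fun x _ => hasDerivAt_sol_neg bMinus (-k) E x)
      (fun x _ => (hasDerivAt_sol 0 bPlus k E x).const_mul c) m0 m1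
  have hψ₁ : ∀ x, HasDerivAt ψ₁ ((potential bMinus bPlus k x - E) * ψ x) x := by
    intro x
    have := hasDerivAt_glue (fun x _ => hasDerivAt_solDeriv_neg hm k E x)
      (fun x _ => (hasDerivAt_solDeriv hp k E x).const_mul c) m1 (by rw [m0]; ring) x
    refine this.congr_deriv ?_
    rcases le_total 0 x with hx | hx
    · rw [glue_of_nonneg _ _ hx, potential_of_nonneg hx]
      simp only [ψ, glue_of_nonneg _ _ hx]
      ring
    · rw [glue_of_nonpos (by rw [m0]; ring) hx, potential_of_nonpos hx]
      simp only [ψ]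
      rw [glue_of_nonpos m0 hx]
  have hψc : Continuous ψ := continuous_iff_continuousAt.2 fun x => (hψ x).continuousAt
  have hψ₁c : Continuous ψ₁ := continuous_iff_continuousAt.2 fun x => (hψ₁ x).continuousAt
  have hψL : MemLp ψ 2 := by
    refine memLp_two_of_tendsto hψc ?_ ?_
    · have := (tendsto_mul_sol hp k E).const_mul c
      rw [mul_zero] at this
      refine this.congr' ?_
      filter_upwards [eventually_ge_atTop 0] with x hx
      simp only [ψ, glue_of_nonneg _ _ hx]
      ring
    · refine (tendsto_mul_sol_neg hm (-k) E).congr' ?_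
      filter_upwards [eventually_le_atBot 0] with x hx
      simp only [ψ]
      rw [glue_of_nonpos m0 hx]
  have hψLC : MemLp (fun x => (ψ x : ℂ)) 2 := hψL.ofReal
  refine mem_eigenvalues_iff.2 ⟨hψLC.toLp _, fun hzero => ?_, fun φ hφ hφc => ?_⟩
  · have hae : (fun x => (ψ x : ℂ)) =ᵐ[volume] fun _ => 0 := by
      have h1 := hψLC.coeFn_toLp
      rw [hzero] at h1
      exact h1.symm.trans (Lp.coeFn_zero ℂ 2 volume)
    have hall : (fun x => (ψ x : ℂ)) = fun _ => 0 :=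
      (Complex.continuous_ofReal.comp hψc).ae_eq_iff_eq volume continuous_const |>.1 hae
    have hψ0 : ψ = fun _ => 0 := funext fun x => by exact_mod_cast congrFun hall x
    have hψ₁0 : ψ₁ 0 = 0 := by
      have := hψ 0
      rw [hψ0] at this
      exact this.unique (hasDerivAt_const 0 0)
    have hψ00 : ψ 0 = 0 := by rw [hψ0]
    simp only [ψ, ψ₁, glue_of_nonneg _ _ le_rfl, mul_eq_zero, hc, false_or] at hψ₁0 hψ00
    exact (sol_ne_zero_or hp k E 0).elim (fun h => h hψ00) (fun h => h hψ₁0)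
  · have hcongr : ∫ x, (applyFormal bMinus bPlus k φ x - E * φ x) • (hψLC.toLp _) x =
        ∫ x, (((applyFormal bMinus bPlus k φ x - E * φ x) * ψ x : ℝ) : ℂ) := by
      refine integral_congr_ae ?_
      filter_upwards [hψLC.coeFn_toLp] with x hx
      rw [hx]
      simp
    have hφ' : ContDiff ℝ ∞ (deriv φ) := (contDiff_infty_iff_deriv.1 hφ).2
    have hφ'' : ContDiff ℝ ∞ (deriv (deriv φ)) := (contDiff_infty_iff_deriv.1 hφ').2
    have hcont : Continuous fun x => applyFormal bMinus bPlus k φ x - E * φ x :=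
      (applyFormal_continuous bMinus bPlus k hφ).sub (hφ.continuous.const_mul E)
    have hsupp : HasCompactSupport fun x => applyFormal bMinus bPlus k φ x - E * φ x :=
      (applyFormal_hasCompactSupport bMinus bPlus k hφc).sub (hφc.mul_left)
    rw [hcongr, integral_complex_ofReal, Complex.ofReal_eq_zero]
    -- Green's identity: the integrand is the derivative of the compactly supported function `φ ψ' -
    -- φ' ψ`.
    refine integral_eq_zero_of_hasDerivAt_of_integrable
      (f := fun x => φ x * ψ₁ x - deriv φ x * ψ x) (fun x => ?_)
      ((hcont.mul hψc).integrable_of_hasCompactSupport hsupp.mul_right)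
      (((hφ.continuous.mul hψ₁c).sub (hφ'.continuous.mul hψc)).integrable_of_hasCompactSupport
        (hφc.mul_right.sub hφc.deriv.mul_right))
    have d0 := (hφ.differentiable (by simp) x).hasDerivAt
    have d1 := (hφ'.differentiable (by simp) x).hasDerivAt
    refine ((d0.mul (hψ₁ x)).sub (d1.mul (hψ x))).congr_deriv ?_
    rw [applyFormal]
    ring

end Eigenvalues

/-- Variation of constants with two solutions whose Wronskian is `c ≠ 0`. -/
theorem exists_green {Q p p₁ q q₁ f : ℝ → ℝ} {c : ℝ} (hp : ∀ x, HasDerivAt p (p₁ x) x)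
    (hp₁ : ∀ x, HasDerivAt p₁ (Q x * p x) x) (hq : ∀ x, HasDerivAt q (q₁ x) x)
    (hq₁ : ∀ x, HasDerivAt q₁ (Q x * q x) x) (hw : ∀ x, p x * q₁ x - p₁ x * q x = c) (hc : c ≠ 0)
    (hf : Continuous f) (hfs : HasCompactSupport f) :
    ∃ φ φ₁ : ℝ → ℝ, (∀ x, HasDerivAt φ (φ₁ x) x) ∧
      (∀ x, HasDerivAt φ₁ (Q x * φ x - f x) x) ∧
      (∃ a, ∀ᶠ x in atTop, φ x = a * p x ∧ φ₁ x = a * p₁ x) ∧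
      ∃ b, ∀ᶠ x in atBot, φ x = b * q x ∧ φ₁ x = b * q₁ x := by
  have hpc : Continuous p := continuous_iff_continuousAt.2 fun x => (hp x).continuousAt
  have hqc : Continuous q := continuous_iff_continuousAt.2 fun x => (hq x).continuousAt
  obtain ⟨R₀, hR₀⟩ := hfs.isCompact.isBounded.subset_closedBall (0 : ℝ)
  set R := |R₀| + 1
  have hR : 0 < R := by positivity
  have hf0 : ∀ x, R ≤ |x| → f x = 0 := by
    intro x hx
    refine image_eq_zero_of_notMem_tsupport fun h => ?_
    have h1 : |x| ≤ R₀ := by simpa using hR₀ h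
    have h2 := le_abs_self R₀
    simp only [R] at hx
    linarith
  -- The base points `-R` and `R` are chosen so that `A` vanishes to the left of the support of `f`
  -- and `B` to the right of it; there only the multiple of `q`, respectively of `p`, survives.
  set A : ℝ → ℝ := fun x => ∫ y in (-R)..x, q y * f y
  set B : ℝ → ℝ := fun x => ∫ y in R..x, p y * f y
  have hqf : Continuous fun y => q y * f y := hqc.mul hf
  have hpf : Continuous fun y => p y * f y := hpc.mul hf
  have hA : ∀ x, HasDerivAt A (q x * f x) x := fun x =>
    (hqf.integral_hasStrictDerivAt (-R) x).hasDerivAt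
  have hB : ∀ x, HasDerivAt B (p x * f x) x := fun x =>
    (hpf.integral_hasStrictDerivAt R x).hasDerivAt
  have hAbot : ∀ x, x ≤ -R → A x = 0 := by
    intro x hx
    refine (intervalIntegral.integral_congr (g := fun _ => (0 : ℝ)) fun y hy => ?_).trans (by simp)
    rw [uIcc_of_ge hx] at hy
    have : R ≤ |y| := le_trans (by linarith [hy.2]) (neg_le_abs y)
    simp [hf0 y this]
  have hBtop : ∀ x, R ≤ x → B x = 0 := by
    intro x hx
    refine (intervalIntegral.integral_congr (g := fun _ => (0 : ℝ)) fun y hy => ?_).trans (by simp)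
    rw [uIcc_of_le hx] at hy
    have : R ≤ |y| := hy.1.trans (le_abs_self y)
    simp [hf0 y this]
  have hAtop : ∀ x, R ≤ x → A x = A R := by
    intro x hx
    rw [← sub_eq_zero]
    refine (intervalIntegral.integral_interval_sub_left (hqf.intervalIntegrable _ _)
      (hqf.intervalIntegrable _ _)).trans ?_
    refine (intervalIntegral.integral_congr (g := fun _ => (0 : ℝ)) fun y hy => ?_).trans (by simp)
    rw [uIcc_of_le hx] at hy
    have : R ≤ |y| := hy.1.trans (le_abs_self y)
    simp [hf0 y this]
  have hBbot : ∀ x, x ≤ -R → B x = B (-R) := by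
    intro x hx
    rw [← sub_eq_zero]
    refine (intervalIntegral.integral_interval_sub_left (hpf.intervalIntegrable _ _)
      (hpf.intervalIntegrable _ _)).trans ?_
    refine (intervalIntegral.integral_congr (g := fun _ => (0 : ℝ)) fun y hy => ?_).trans (by simp)
    rw [uIcc_of_ge hx] at hy
    have : R ≤ |y| := le_trans (by linarith [hy.2]) (neg_le_abs y)
    simp [hf0 y this]
  refine ⟨fun x => (p x * A x - q x * B x) / c, fun x => (p₁ x * A x - q₁ x * B x) / c,
    fun x => ?_, fun x => ?_, ⟨A R / c, ?_⟩, -B (-R) / c, ?_⟩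
  · refine ((((hp x).mul (hA x)).sub ((hq x).mul (hB x))).div_const c).congr_deriv ?_
    ring
  · refine ((((hp₁ x).mul (hA x)).sub ((hq₁ x).mul (hB x))).div_const c).congr_deriv ?_
    have := hw x
    field_simp
    rw [← this]
    ring
  · filter_upwards [eventually_ge_atTop R] with x hx
    rw [hAtop x hx, hBtop x hx]
    constructor <;> ring
  · filter_upwards [eventually_le_atBot (-R)] with x hx
    rw [hAbot x hx, hBbot x hx]
    constructor <;> ring

/-! ### The eigenvalue condition and the bands -/

section Main

variable {bMinus bPlus k E : ℝ}

theorem exists_solution_decaying_right (hp : 0 < bPlus) (bMinus k E : ℝ) :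
    ∃ p p₁ : ℝ → ℝ, p 0 = sol 0 bPlus k E 0 ∧ p₁ 0 = solDeriv 0 bPlus k E 0 ∧
      (∀ x, HasDerivAt p (p₁ x) x) ∧
      (∀ x, HasDerivAt p₁ ((potential bMinus bPlus k x - E) * p x) x) ∧
      Tendsto (fun x => x * p x) atTop (𝓝 0) ∧ Tendsto (fun x => x * p₁ x) atTop (𝓝 0) := by
  have hV := continuous_potential bMinus bPlus k
  obtain ⟨e, e₁, h0, h1, he, he₁⟩ := exists_solution
    (by fun_prop : Continuous fun x => potential bMinus bPlus k x - E)
    (sol 0 bPlus k E 0) (solDeriv 0 bPlus k E 0)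
  refine ⟨glue e (sol 0 bPlus k E), glue e₁ (solDeriv 0 bPlus k E), glue_of_nonneg _ _ le_rfl,
    glue_of_nonneg _ _ le_rfl, hasDerivAt_glue (fun x _ => he x)
      (fun x _ => hasDerivAt_sol 0 bPlus k E x) h0 h1, fun x => ?_, ?_, ?_⟩
  · have := hasDerivAt_glue (g' := fun x => (potential bMinus bPlus k x - E) * sol 0 bPlus k E x)
      (fun x _ => he₁ x)
      (fun x hx => by rw [potential_of_nonneg hx]; exact hasDerivAt_solDeriv hp k E x)
      h1 (by rw [h0]) x
    refine this.congr_deriv ?_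
    rcases le_total 0 x with hx | hx
    · rw [glue_of_nonneg _ _ hx, glue_of_nonneg _ _ hx]
    · rw [glue_of_nonpos (by rw [h0]) hx, glue_of_nonpos h0 hx]
  · refine (tendsto_mul_sol hp k E).congr' ?_
    filter_upwards [eventually_ge_atTop 0] with x hx
    rw [glue_of_nonneg _ _ hx]
  · refine (tendsto_mul_solDeriv hp k E).congr' ?_
    filter_upwards [eventually_ge_atTop 0] with x hx
    rw [glue_of_nonneg _ _ hx]

theorem exists_solution_decaying_left (hm : 0 < bMinus) (bPlus k E : ℝ) :
    ∃ q q₁ : ℝ → ℝ, q 0 = sol 0 bMinus (-k) E 0 ∧ q₁ 0 = -solDeriv 0 bMinus (-k) E 0 ∧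
      (∀ x, HasDerivAt q (q₁ x) x) ∧
      (∀ x, HasDerivAt q₁ ((potential bMinus bPlus k x - E) * q x) x) ∧
      Tendsto (fun x => x * q x) atBot (𝓝 0) ∧ Tendsto (fun x => x * q₁ x) atBot (𝓝 0) := by
  have hV := continuous_potential bMinus bPlus k
  obtain ⟨e, e₁, h0, h1, he, he₁⟩ := exists_solution
    (by fun_prop : Continuous fun x => potential bMinus bPlus k x - E)
    (sol 0 bMinus (-k) E (-0)) (-solDeriv 0 bMinus (-k) E (-0))
  refine ⟨glue (fun x => sol 0 bMinus (-k) E (-x)) e,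
    glue (fun x => -solDeriv 0 bMinus (-k) E (-x)) e₁,
    by rw [glue_of_nonneg _ _ le_rfl, h0, neg_zero],
    by rw [glue_of_nonneg _ _ le_rfl, h1, neg_zero],
    hasDerivAt_glue (fun x _ => hasDerivAt_sol_neg bMinus (-k) E x)
      (fun x _ => he x) h0.symm h1.symm, fun x => ?_, ?_, ?_⟩
  · have := hasDerivAt_glue
      (f' := fun x => (potential bMinus bPlus k x - E) * sol 0 bMinus (-k) E (-x))
      (fun x hx => by rw [potential_of_nonpos hx]; exact hasDerivAt_solDeriv_neg hm k E x)
      (fun x _ => he₁ x) h1.symm (by rw [h0]) x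
    refine this.congr_deriv ?_
    rcases le_total 0 x with hx | hx
    · rw [glue_of_nonneg _ _ hx, glue_of_nonneg _ _ hx]
    · rw [glue_of_nonpos (by rw [h0]) hx, glue_of_nonpos h0.symm hx]
  · refine (tendsto_mul_sol_neg hm (-k) E).congr' ?_
    filter_upwards [eventually_le_atBot 0] with x hx
    rw [glue_of_nonpos h0.symm hx]
  · refine (tendsto_mul_solDeriv_neg hm (-k) E).congr' ?_
    filter_upwards [eventually_le_atBot 0] with x hx
    rw [glue_of_nonpos h1.symm hx]

/-- If the Wronskian does not vanish, every test function `f` is the image of a function decaying at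
both ends, so a weak eigenfunction integrates to zero against every `f`. -/
theorem secular_eq_zero_of_mem_eigenvalues (hm : 0 < bMinus) (hp : 0 < bPlus)
    (hE : E ∈ eigenvalues bMinus bPlus k) : secular bMinus bPlus k E = 0 := by
  obtain ⟨u, hu0, hu⟩ := mem_eigenvalues_iff.1 hE
  by_contra hne
  refine hu0 ((Lp.eq_zero_iff_ae_eq_zero).2 (ae_eq_zero_of_integral_contDiff_smul_eq_zero
    ((Lp.memLp u).locallyIntegrable (by norm_num)) fun f hf hfs => ?_))
  obtain ⟨p, p₁, hp0, hp1, hpd, hpd₁, hpt, hpt₁⟩ := exists_solution_decaying_right hp bMinus k E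
  obtain ⟨q, q₁, hq0, hq1, hqd, hqd₁, hqt, hqt₁⟩ := exists_solution_decaying_left hm bPlus k E
  have hw : ∀ x, p x * q₁ x - p₁ x * q x = -secular bMinus bPlus k E := by
    have hd : ∀ x, HasDerivAt (fun x => p x * q₁ x - p₁ x * q x) 0 x := fun x => by
      refine (((hpd x).mul (hqd₁ x)).sub ((hpd₁ x).mul (hqd x))).congr_deriv ?_
      ring
    intro x
    rw [is_const_of_deriv_eq_zero (fun x => (hd x).differentiableAt) (fun x => (hd x).deriv) x 0,
      hp0, hp1, hq0, hq1, secular]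
    ring
  obtain ⟨φ, φ₁, h1, h2, ⟨a, ha⟩, b, hb⟩ := exists_green hpd hpd₁ hqd hqd₁ hw (neg_ne_zero.2 hne)
    hf.continuous hfs
  have hφc : Continuous φ := continuous_iff_continuousAt.2 fun x => (h1 x).continuousAt
  have hφ₁c : Continuous φ₁ := continuous_iff_continuousAt.2 fun x => (h2 x).continuousAt
  have hV := continuous_potential bMinus bPlus k
  have hfc := hf.continuous
  have tail : ∀ {l : Filter ℝ} {g r : ℝ → ℝ} {a : ℝ}, Tendsto (fun x => x * r x) l (𝓝 0) →
      (∀ᶠ x in l, g x = a * r x) → Tendsto (fun x => x * g x) l (𝓝 0) := by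
    intro l g r a h hev
    have h' := h.const_mul a
    rw [mul_zero] at h'
    refine h'.congr' ?_
    filter_upwards [hev] with x hx
    rw [hx]
    ring
  refine hu.integral_eq_zero_of_memLp h1 h2 (by fun_prop)
    (memLp_two_of_tendsto hφc (tail hpt (ha.mono fun _ h => h.1))
      (tail hqt (hb.mono fun _ h => h.1)))
    (memLp_two_of_tendsto hφ₁c (tail hpt₁ (ha.mono fun _ h => h.2))
      (tail hqt₁ (hb.mono fun _ h => h.2))) hfc (fun x => ?_) hfs
  ring

theorem eigenvalues_eq (hm : 0 < bMinus) (hp : 0 < bPlus) (k : ℝ) :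
    eigenvalues bMinus bPlus k = {E | secular bMinus bPlus k E = 0} :=
  Subset.antisymm (fun _ h => secular_eq_zero_of_mem_eigenvalues hm hp h)
    fun _ h => mem_eigenvalues_of_secular_eq_zero hm hp h

theorem exists_hasDerivAt_band_pos (hm : 0 < bMinus) (hlt : bMinus < bPlus) (j : ℕ) (k : ℝ) :
    ∃ d, 0 < d ∧ HasDerivAt (band bMinus bPlus j) d k := by
  have hp : 0 < bPlus := hm.trans hlt
  have hne : ∀ k E, secular bMinus bPlus k E = 0 → secularEnergy bMinus bPlus k E ≠ 0 :=
    fun k E h h0 => by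
      have := secularMomentum_mul_secularEnergy_neg hm hlt h
      rw [h0, mul_zero] at this
      exact this.false
  have hfun : band bMinus bPlus j =
      fun k => increasingEnum {E | secular bMinus bPlus k E = 0} (j - 1) := by
    funext k
    rw [band, eigenvalues_eq hm hp]
  rw [hfun]
  refine ⟨_, ?_, hasDerivAt_increasingEnum_zeros (hasDerivAt_secular_momentum hm hp)
    (hasDerivAt_secular_energy bMinus bPlus) (continuous_secularMomentum bMinus bPlus)
    (continuous_secularEnergy bMinus bPlus) (continuous_secular bMinus bPlus) hne
    (fun k _ hE => secular_ne_zero_of_nonpos hm hp k hE)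
    (fun k b => exists_secular_eq_zero hm hp k b) (j - 1) k⟩
  have hmem := increasingEnum_mem
    (finite_zeros_inter_Iic (hasDerivAt_secular_energy bMinus bPlus k) (hne k)
      (fun _ hE => secular_ne_zero_of_nonpos hm hp k hE))
    (fun b => exists_secular_eq_zero hm hp k b) (j - 1)
  have hneg := secularMomentum_mul_secularEnergy_neg hm hlt hmem
  rw [neg_div, neg_pos]
  rcases mul_neg_iff.1 hneg with h | h
  · exact div_neg_of_pos_of_neg h.1 h.2
  · exact div_neg_of_neg_of_pos h.1 h.2

end Main

end Iwatsuka

end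

theorem lemma3p1 (bMinus bPlus : ℝ) (hMinus : 0 < bMinus) (hlt : bMinus < bPlus) :
    (∀ k : ℝ,
      StrictMonoOn (fun j : ℕ => Iwatsuka.band bMinus bPlus j k) (Set.Ici 1) ∧
      (fun j : ℕ => Iwatsuka.band bMinus bPlus j k) '' Set.Ici 1 =
        Iwatsuka.eigenvalues bMinus bPlus k) ∧
    ∀ j : ℕ, 1 ≤ j →
      StrictMono (Iwatsuka.band bMinus bPlus j) ∧
      ∀ k : ℝ, DifferentiableAt ℝ (Iwatsuka.band bMinus bPlus j) k ∧
        0 < deriv (Iwatsuka.band bMinus bPlus j) k := by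
  have hp : 0 < bPlus := hMinus.trans hlt
  refine ⟨fun k => ?_, fun j _ => ?_⟩
  · have hfin : ∀ b, (Iwatsuka.eigenvalues bMinus bPlus k ∩ Iic b).Finite := by
      rw [Iwatsuka.eigenvalues_eq hMinus hp]
      refine Iwatsuka.finite_zeros_inter_Iic
        (Iwatsuka.hasDerivAt_secular_energy bMinus bPlus k) (fun E h h0 => ?_)
        (fun _ hE => Iwatsuka.secular_ne_zero_of_nonpos hMinus hp k hE)
      have := Iwatsuka.secularMomentum_mul_secularEnergy_neg hMinus hlt h
      rw [h0, mul_zero] at this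
      exact this.false
    have hunb : ∀ b, ∃ E ∈ Iwatsuka.eigenvalues bMinus bPlus k, b < E := by
      rw [Iwatsuka.eigenvalues_eq hMinus hp]
      exact fun b => Iwatsuka.exists_secular_eq_zero hMinus hp k b
    refine ⟨fun i hi j hj hij => ?_, ?_⟩
    -- The enumeration starts at `0` while bands are numbered from `1`; the shift `j - 1` is
    -- truncated, so `1 ≤ i` is needed to keep the inequality strict.
    · refine Iwatsuka.strictMono_increasingEnum hfin hunb ?_
      have := mem_Ici.1 hi
      omega
    · refine Eq.trans ?_ (Iwatsuka.range_increasingEnum hfin hunb)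
      refine Subset.antisymm ?_ ?_
      · rintro _ ⟨j, _, rfl⟩
        exact ⟨j - 1, rfl⟩
      · rintro _ ⟨n, rfl⟩
        exact ⟨n + 1, by simp, rfl⟩
  · have hd : ∀ k, 0 < deriv (Iwatsuka.band bMinus bPlus j) k := fun k => by
      obtain ⟨d, hd, h⟩ := Iwatsuka.exists_hasDerivAt_band_pos hMinus hlt j k
      rwa [h.deriv]
    refine ⟨strictMono_of_deriv_pos hd, fun k => ⟨?_, hd k⟩⟩
    obtain ⟨d, _, h⟩ := Iwatsuka.exists_hasDerivAt_band_pos hMinus hlt j k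
    exact h.differentiableAt
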